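/- Let $l\ge 0$ and $n,m\ge 2$ be integers, and put $N=(1,\dots,1,n,m)$ with $l$ ones, so that $|N|=l+n+m$. For $u,v\in\mathbb C^k$ write $u\bullet v=\sum_j u_jv_j$ and $|u|=\sqrt{u\bullet\bar u}$. Points of $\mathbb C^{|N|+2}=\mathbb C^l\times\mathbb C^{n+1}\times\mathbb C^{m+1}$ are written $Z=(x,z,w)$ and $\Theta=(\xi,\zeta,\eta)$. Let $\mathbb B_N$ be the open Euclidean unit ball of $\mathbb C^{|N|+2}$, let $$\mathbb H_N=\{(x,z,w)\in\mathbb C^l\times(\mathbb C^{n+1}\setminus\{0\})\times(\mathbb C^{m+1}\setminus\{0\}) : z\bullet z=w\bullet w=0\},\qquad \mathbb M_N=\mathbb H_N\cap\mathbb B_N,$$ and let $dV$ be the canonical volume measure of the complex manifold $\mathbb H_N$, i.e. the $2|N|$-dimensional volume induced from the Euclidean space $\mathbb C^{|N|+2}$. **Theorem 7.1.** Let $\lambda>0$ and let $\alpha_1,\alpha_2,\alpha_3,\alpha_4$ be real numbers with $0\le\alpha_3,\alpha_4<2$, $0\le\alpha_1+\alpha_3<2n$ and $0\le\alpha_2+\alpha_4<2m$.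 Then there is a finite constant $C>0$, depending only on $l,n,m,\lambda,\alpha_1,\dots,\alpha_4$, such that for every $Z=(x,z,w)\in\mathbb B_N$ $$\int_{\mathbb M_N}\frac{1}{|1-\Theta\bullet\bar Z|^{|N|+1+\lambda}}\Bigl(1+\frac{|z|}{|\zeta|}\Bigr)^{\alpha_1}\Bigl(1+\frac{|w|}{|\eta|}\Bigr)^{\alpha_2}\Bigl|\frac{\zeta}{\zeta_{n+1}}\Bigr|^{\alpha_3}\Bigl|\frac{\eta}{\eta_{m+1}}\Bigr|^{\alpha_4}\,dV(\Theta)\le C\,(1-|Z|^2)^{-(\lambda+\frac{\alpha_3}{2}+\frac{\alpha_4}{2})}.$$ -/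

import Mathlib

open scoped ENNReal MeasureTheory ComplexConjugate

/-- The bilinear (not sesquilinear) product `u • v = ∑ₖ uₖ vₖ` on `ℂᵏ`. -/
noncomputable def bdot {ι : Type} [Fintype ι] (u v : EuclideanSpace ℂ ι) : ℂ :=
  ∑ k, u k * v k

/-- Coordinatewise complex conjugation on `ℂᵏ`. -/
noncomputable def vconj {ι : Type} (u : EuclideanSpace ℂ ι) : EuclideanSpace ℂ ι :=
  WithLp.toLp 2 fun k => conj (u k)

/-- The ambient space `ℂˡ × ℂⁿ⁺¹ × ℂᵐ⁺¹ = ℂ^(|N|+2)`, with its Euclidean norm, where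
`N = (1,…,1,n,m)` (`l` ones) and `|N| = l + n + m`. -/
abbrev AmbN (l n m : ℕ) : Type :=
  EuclideanSpace ℂ (Fin l ⊕ (Fin (n + 1) ⊕ Fin (m + 1)))

/-- The component in `ℂⁿ⁺¹` (`z` of `Z = (x,z,w)`, `ζ` of `Θ = (ξ,ζ,η)`). -/
noncomputable def partZ {l n m : ℕ} (Z : AmbN l n m) : EuclideanSpace ℂ (Fin (n + 1)) :=
  WithLp.toLp 2 fun j => Z (Sum.inr (Sum.inl j))

/-- The component in `ℂᵐ⁺¹` (`w` of `Z = (x,z,w)`, `η` of `Θ = (ξ,ζ,η)`). -/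
noncomputable def partW {l n m : ℕ} (Z : AmbN l n m) : EuclideanSpace ℂ (Fin (m + 1)) :=
  WithLp.toLp 2 fun k => Z (Sum.inr (Sum.inr k))

/-- The open Euclidean unit ball `𝔹_N` of `ℂ^(|N|+2)`. -/
def BallN (l n m : ℕ) : Set (AmbN l n m) := Metric.ball 0 1

/-- The complex manifold `ℍ_N`, of complex dimension `|N| = l + n + m`. -/
def HypN (l n m : ℕ) : Set (AmbN l n m) :=
  {Z | partZ Z ≠ 0 ∧ partW Z ≠ 0 ∧ bdot (partZ Z) (partZ Z) = 0 ∧ bdot (partW Z) (partW Z) = 0}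

/-- `𝕄_N = ℍ_N ∩ 𝔹_N`. -/
def ManN (l n m : ℕ) : Set (AmbN l n m) := HypN l n m ∩ BallN l n m

/-- The canonical measure `dV` on `ℍ_N`: its volume as a submanifold of real dimension `2|N|`
of Euclidean space, that is, the `2|N|`-dimensional Hausdorff measure, normalized so as to agree
with Lebesgue measure on `ℝ^(2|N|)`, restricted to `ℍ_N`. -/
noncomputable def volN (l n m : ℕ) : MeasureTheory.Measure (AmbN l n m) :=
  (μHE[2 * (l + n + m)]).restrict (HypN l n m)

/-- The kernel `K_{λ,Z}(Θ) = 1 / |1 - Θ • Z̄|^(|N|+1+λ)`. -/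
noncomputable def kernelN {l n m : ℕ} (lam : ℝ) (Z Θ : AmbN l n m) : ℝ :=
  1 / ‖1 - bdot Θ (vconj Z)‖ ^ (((l + n + m : ℕ) : ℝ) + 1 + lam)

open MeasureTheory

/-- A map that does not contract distances on `S` increases Hausdorff measures at most by a
constant factor, so integrals over `S` are controlled by Lebesgue integrals over the target. -/
theorem exists_setLIntegral_euclideanHausdorffMeasure_le {X ι : Type*} [EMetricSpace X]
    [MeasurableSpace X] [BorelSpace X] [Nonempty X] [Fintype ι] (d : ℕ) (hd : Fintype.card ι = d)
    (K : NNReal) :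
    ∃ C : ℝ≥0∞, C ≠ ⊤ ∧ ∀ (S : Set X) (p : X → ι → ℂ) (f : X → ℝ≥0∞) (g : (ι → ℂ) → ℝ≥0∞),
      MeasurableSet S → Measurable p → Measurable g →
      (∀ x ∈ S, ∀ y ∈ S, edist x y ≤ K * edist (p x) (p y)) → (∀ x ∈ S, f x ≤ g (p x)) →
      ∫⁻ x in S, f x ∂(μHE[2 * d]) ≤ C * ∫⁻ y, g y := by
  have hfin : Module.finrank ℝ (ι → ℂ) = 2 * d := by
    rw [Module.finrank_pi_fintype]; simp [hd, mul_comm]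
  have : (μHE[2 * d] : Measure (ι → ℂ)).IsAddHaarMeasure := by
    rw [← hfin]; infer_instance
  refine ⟨(K : ℝ≥0∞) ^ (2 * d : ℕ) *
    Measure.addHaarScalarFactor (μHE[2 * d] : Measure (ι → ℂ)) volume, by finiteness, ?_⟩
  intro S p f g hS hp hg hK hfg
  have himage : ∀ A ⊆ S, (μHE[2 * d] : Measure X) A
      ≤ (K : ℝ≥0∞) ^ (2 * d : ℕ) * (μHE[2 * d] : Measure (ι → ℂ)) (p '' A) := by
    intro A hA
    have hinj : Set.InjOn p A := by
      intro x hx y hy hxy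
      have := hK x (hA hx) y (hA hy)
      rw [hxy, edist_self, mul_zero] at this
      exact edist_le_zero.mp this
    have hinv : Set.LeftInvOn (Function.invFunOn p A) p A := hinj.leftInvOn_invFunOn
    have hL : LipschitzOnWith K (Function.invFunOn p A) (p '' A) := by
      rintro _ ⟨x, hx, rfl⟩ _ ⟨y, hy, rfl⟩
      rw [hinv hx, hinv hy]
      exact hK x (hA hx) y (hA hy)
    have := hL.hausdorffMeasure_image_le (d := ((2 * d : ℕ) : ℝ)) (by positivity)
    rw [hinv.image_image, ENNReal.rpow_natCast] at this
    simp only [Measure.euclideanHausdorffMeasure_def, Measure.smul_apply, ENNReal.smul_def,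
      smul_eq_mul]
    exact (mul_le_mul' le_rfl this).trans (le_of_eq (mul_left_comm _ _ _))
  have hvol := Measure.isAddLeftInvariant_eq_smul (μHE[2 * d] : Measure (ι → ℂ)) volume
  have hmap : ((μHE[2 * d] : Measure X).restrict S).map p ≤ ((K : ℝ≥0∞) ^ (2 * d : ℕ) *
      Measure.addHaarScalarFactor (μHE[2 * d] : Measure (ι → ℂ)) volume) • volume := by
    refine Measure.le_iff.mpr fun B hB => ?_
    rw [Measure.map_apply hp hB, Measure.restrict_apply (hp hB)]
    refine (himage _ Set.inter_subset_right).trans ?_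
    rw [Measure.smul_apply, smul_eq_mul, mul_assoc]
    gcongr
    have hsub : p '' (p ⁻¹' B ∩ S) ⊆ B := by
      rintro _ ⟨x, hx, rfl⟩; exact hx.1
    refine (measure_mono hsub).trans (le_of_eq ?_)
    conv_lhs => rw [hvol]
    rfl
  calc ∫⁻ x in S, f x ∂(μHE[2 * d]) ≤ ∫⁻ x in S, g (p x) ∂(μHE[2 * d]) := setLIntegral_mono' hS hfg
    _ = ∫⁻ y, g y ∂(((μHE[2 * d] : Measure X).restrict S).map p) := (lintegral_map hg hp).symm
    _ ≤ _ := lintegral_mono' hmap le_rfl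
    _ = _ := by rw [lintegral_smul_measure, smul_eq_mul]

theorem lintegral_fintype_prod {ι E : Type*} [Fintype ι] [MeasureSpace E]
    [SigmaFinite (volume : Measure E)] (f : ι → E → ℝ≥0∞) (hf : ∀ i, Measurable (f i)) :
    ∫⁻ y : ι → E, ∏ i, f i (y i) = ∏ i, ∫⁻ x, f i x := by
  classical
  rcases isEmpty_or_nonempty (ι → E) with h | ⟨⟨x₀⟩⟩
  · obtain ⟨i, hi⟩ := isEmpty_pi.mp h
    rw [lintegral_of_isEmpty, eq_comm]
    exact Finset.prod_eq_zero (Finset.mem_univ i) (by rw [lintegral_of_isEmpty])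
  have hmeas : Measurable fun y : ι → E => ∏ i, f i (y i) :=
    Finset.measurable_prod _ fun i _ => (hf i).comp (measurable_pi_apply i)
  have key : ∀ s : Finset ι, ∀ x : ι → E,
      (∫⋯∫⁻_s, (fun y : ι → E => ∏ i, f i (y i)) ∂fun _ => (volume : Measure E)) x
        = (∏ i ∈ s, ∫⁻ a, f i a) * ∏ i ∈ sᶜ, f i (x i) := by
    intro s
    induction s using Finset.induction_on with
    | empty => intro x; simp
    | insert i s hi ih =>
      intro x
      have hc : sᶜ = insert i (insert i s)ᶜ := by
        ext j; simp only [Finset.mem_compl, Finset.mem_insert]; grind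
      have hni : i ∉ (insert i s)ᶜ := by simp
      rw [lmarginal_insert _ hmeas hi]
      simp only [ih]
      rw [Finset.prod_insert hi, hc]
      simp only [Finset.prod_insert hni, Function.update_self]
      have : ∀ a : E, ∏ j ∈ (insert i s)ᶜ, f j (Function.update x i a j)
          = ∏ j ∈ (insert i s)ᶜ, f j (x j) := fun a =>
        Finset.prod_congr rfl fun j hj => by
          rw [Function.update_of_ne]; rintro rfl; exact hni hj
      simp only [this]
      have h1 : ∀ a, (∏ i ∈ s, ∫⁻ a, f i a) * (f i a * ∏ j ∈ (insert i s)ᶜ, f j (x j))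
          = ((∏ i ∈ s, ∫⁻ a, f i a) * ∏ j ∈ (insert i s)ᶜ, f j (x j)) * f i a := fun a => by ring
      simp only [h1]
      rw [lintegral_const_mul _ (hf i)]
      ring
  have := key Finset.univ x₀
  rw [← lintegral_eq_lmarginal_univ] at this
  simpa [volume_pi] using this

/-- `|y|^{-γ}` is integrable near `0` in `ℂ` for `γ < 2`. -/
theorem exists_lintegral_closedBall_enorm_inv_rpow_le (γ : ℝ) (h0 : 0 ≤ γ) (h2 : γ < 2) :
    ∃ C : ℝ, 0 < C ∧ ∀ (a : ℂ) (ρ : ℝ), 0 < ρ →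
      ∫⁻ y in Metric.closedBall a ρ, (‖y‖ₑ⁻¹) ^ γ ≤ ENNReal.ofReal (C * ρ ^ (2 - γ)) := by
  have hcenter : ∀ ρ : ℝ, 0 < ρ → ∫⁻ y in Metric.closedBall (0 : ℂ) ρ, (‖y‖ₑ⁻¹) ^ γ
      ≤ ENNReal.ofReal (2 * Real.pi * ρ ^ (2 - γ) / (2 - γ)) := by
    intro ρ hρ
    rw [← lintegral_indicator Metric.isClosed_closedBall.measurableSet,
      ← Complex.lintegral_comp_polarCoord_symm]
    have hle : ∀ q ∈ polarCoord.target, ENNReal.ofReal q.1 •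
        (Metric.closedBall (0 : ℂ) ρ).indicator (fun y => (‖y‖ₑ⁻¹) ^ γ)
          (Complex.polarCoord.symm q)
        ≤ (Set.Ioc 0 ρ ×ˢ Set.Ioo (-Real.pi) Real.pi).indicator
          (fun q : ℝ × ℝ => ENNReal.ofReal (q.1 ^ (1 - γ))) q := by
      rintro ⟨s, θ⟩ hq
      simp only [polarCoord_target, Set.mem_prod, Set.mem_Ioi] at hq
      have hn : ‖Complex.polarCoord.symm (s, θ)‖ = s := by
        rw [Complex.norm_polarCoord_symm]; exact abs_of_pos hq.1
      by_cases hs : s ≤ ρ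
      · rw [Set.indicator_of_mem (by simpa [abs_of_pos hq.1] using hs),
          Set.indicator_of_mem (by exact ⟨⟨hq.1, hs⟩, hq.2⟩), ← ofReal_norm, hn,
          ← ENNReal.ofReal_inv_of_pos hq.1,
          ENNReal.ofReal_rpow_of_pos (inv_pos.mpr hq.1), smul_eq_mul,
          ← ENNReal.ofReal_mul hq.1.le]
        refine ENNReal.ofReal_le_ofReal (le_of_eq ?_)
        simp only
        rw [Real.inv_rpow hq.1.le, Real.rpow_sub hq.1, Real.rpow_one, div_eq_mul_inv]
      · rw [Set.indicator_of_notMem (by simpa [abs_of_pos hq.1] using hs)]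
        simp
    refine (setLIntegral_mono' (measurableSet_Ioi.prod measurableSet_Ioo) hle).trans ?_
    refine (setLIntegral_le_lintegral _ _).trans ?_
    rw [lintegral_indicator (measurableSet_Ioc.prod measurableSet_Ioo), Measure.volume_eq_prod,
      ← Measure.prod_restrict, lintegral_prod _ (by fun_prop)]
    simp only [lintegral_const, Measure.restrict_apply_univ, Real.volume_Ioo]
    rw [lintegral_mul_const _ (by fun_prop)]
    rw [← ofReal_integral_eq_lintegral_ofReal, ← ENNReal.ofReal_mul]
    · refine ENNReal.ofReal_le_ofReal (le_of_eq ?_)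
      rw [← intervalIntegral.integral_of_le hρ.le, integral_rpow (Or.inl (by linarith)),
        Real.zero_rpow (by linarith)]
      ring_nf
    · exact setIntegral_nonneg measurableSet_Ioc fun x hx => Real.rpow_nonneg hx.1.le _
    · exact (intervalIntegrable_iff_integrableOn_Ioc_of_le hρ.le).mp
        (intervalIntegral.intervalIntegrable_rpow' (by linarith))
    · exact (ae_restrict_iff' measurableSet_Ioc).mpr
        (Filter.Eventually.of_forall fun x hx => Real.rpow_nonneg hx.1.le _)
  refine ⟨2 * Real.pi / (2 - γ) + Real.pi, by
    have := Real.pi_pos; have : 0 < 2 - γ := by linarith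
    positivity, fun a ρ hρ => ?_⟩
  have hsplit : ∫⁻ y in Metric.closedBall a ρ, (‖y‖ₑ⁻¹) ^ γ
      ≤ (∫⁻ y in Metric.closedBall (0 : ℂ) ρ, (‖y‖ₑ⁻¹) ^ γ)
        + ∫⁻ y in Metric.closedBall a ρ \ Metric.closedBall (0 : ℂ) ρ, (‖y‖ₑ⁻¹) ^ γ :=
    (lintegral_mono_set (fun y hy => by
      by_cases h : y ∈ Metric.closedBall (0 : ℂ) ρ
      · exact Or.inl h
      · exact Or.inr ⟨hy, h⟩)).trans (lintegral_union_le _ _ _)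
  have hfar : ∫⁻ y in Metric.closedBall a ρ \ Metric.closedBall (0 : ℂ) ρ, (‖y‖ₑ⁻¹) ^ γ
      ≤ ENNReal.ofReal (Real.pi * ρ ^ (2 - γ)) := by
    calc _ ≤ ∫⁻ y in Metric.closedBall a ρ \ Metric.closedBall (0 : ℂ) ρ,
          ENNReal.ofReal ((ρ⁻¹) ^ γ) := by
          refine setLIntegral_mono' (Metric.isClosed_closedBall.measurableSet.diff
            Metric.isClosed_closedBall.measurableSet) fun y hy => ?_
          have hy' : ρ < ‖y‖ := by simpa using hy.2
          rw [← ENNReal.ofReal_rpow_of_pos (inv_pos.mpr hρ), ENNReal.ofReal_inv_of_pos hρ,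
            ← ofReal_norm]
          gcongr
      _ ≤ ENNReal.ofReal ((ρ⁻¹) ^ γ) * volume (Metric.closedBall a ρ) := by
          rw [setLIntegral_const]
          gcongr
          exact Set.sdiff_subset
      _ = _ := by
          rw [Complex.volume_closedBall, Real.inv_rpow hρ.le, Real.rpow_sub hρ, div_eq_mul_inv,
            ← ENNReal.ofReal_pow hρ.le, ENNReal.ofReal_mul Real.pi_pos.le,
            ENNReal.ofReal_mul (by positivity), Real.rpow_two,
            ← NNReal.coe_real_pi, ENNReal.ofReal_coe_nnreal]
          ring
  refine (hsplit.trans (add_le_add (hcenter ρ hρ) hfar)).trans ?_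
  have : 0 < 2 - γ := by linarith
  rw [← ENNReal.ofReal_add (by positivity) (by positivity)]
  exact ENNReal.ofReal_le_ofReal (le_of_eq (by ring))

/-- The one-variable weight `(2 + r / |y|)^δ |y|^{-κ}`. -/
noncomputable def singWeight (δ κ r : ℝ) (y : ℂ) : ℝ≥0∞ :=
  (2 + ENNReal.ofReal r * ‖y‖ₑ⁻¹) ^ δ * (‖y‖ₑ⁻¹) ^ κ

theorem measurable_singWeight (δ κ r : ℝ) : Measurable (singWeight δ κ r) := by
  unfold singWeight; fun_prop

@[simp] theorem singWeight_zero_zero (r : ℝ) (y : ℂ) : singWeight 0 0 r y = 1 := by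
  simp [singWeight]

theorem ENNReal.rpow_sum_of_nonneg {ι : Type*} (s : Finset ι) (x : ℝ≥0∞) {f : ι → ℝ}
    (hf : ∀ i ∈ s, 0 ≤ f i) : x ^ (∑ i ∈ s, f i) = ∏ i ∈ s, x ^ f i := by
  classical
  induction s using Finset.induction_on with
  | empty => simp
  | insert i s hi ih =>
    rw [Finset.sum_insert hi, Finset.prod_insert hi, ENNReal.rpow_add_of_nonneg _ _
      (hf i (Finset.mem_insert_self i s))
      (Finset.sum_nonneg fun j hj => hf j (Finset.mem_insert_of_mem hj)),
      ih fun j hj => hf j (Finset.mem_insert_of_mem hj)]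

theorem ENNReal.two_add_rpow_le {δ : ℝ} (hδ : 0 ≤ δ) (x : ℝ≥0∞) :
    (2 + x) ^ δ ≤ 4 ^ δ * (1 + x ^ δ) := by
  have h4 : (2 : ℝ≥0∞) + 1 ≤ 4 := by norm_num
  rcases le_total x 1 with hx | hx
  · calc (2 + x) ^ δ ≤ 4 ^ δ := by
          gcongr
          exact (add_le_add le_rfl hx).trans h4
      _ ≤ _ := le_mul_of_one_le_right zero_le (le_add_right le_rfl)
  · calc (2 + x) ^ δ ≤ (4 * x) ^ δ := by
          gcongr
          calc 2 + x ≤ 2 * x + x := by gcongr; exact le_mul_of_one_le_right zero_le hx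
            _ = (2 + 1) * x := by ring
            _ ≤ _ := by gcongr
      _ = 4 ^ δ * x ^ δ := ENNReal.mul_rpow_of_nonneg _ _ hδ
      _ ≤ _ := by gcongr; exact le_add_left le_rfl

theorem exists_lintegral_singWeight_le {δ κ A : ℝ} (hδ : 0 ≤ δ) (hκ : 0 ≤ κ) (h : δ + κ < 2)
    (hA : 0 < A) :
    ∃ C : ℝ, 0 < C ∧ ∀ (a : ℂ) (r : ℝ), 0 < r →
      ∫⁻ y, (Metric.closedBall a (A * r)).indicator (singWeight δ κ r) y
        ≤ ENNReal.ofReal (C * r ^ (2 - κ)) := by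
  obtain ⟨C₁, hC₁, h₁⟩ := exists_lintegral_closedBall_enorm_inv_rpow_le κ hκ (by linarith)
  obtain ⟨C₂, hC₂, h₂⟩ := exists_lintegral_closedBall_enorm_inv_rpow_le (δ + κ) (by linarith) h
  refine ⟨4 ^ δ * (C₁ * A ^ (2 - κ) + C₂ * A ^ (2 - (δ + κ))), by positivity,
    fun a r hr => ?_⟩
  rw [lintegral_indicator Metric.isClosed_closedBall.measurableSet]
  have hpt : ∀ y : ℂ, singWeight δ κ r y ≤
      ENNReal.ofReal (4 ^ δ) * ((‖y‖ₑ⁻¹) ^ κ + ENNReal.ofReal (r ^ δ) * (‖y‖ₑ⁻¹) ^ (δ + κ)) := by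
    intro y
    calc singWeight δ κ r y
        ≤ (4 ^ δ * (1 + (ENNReal.ofReal r * ‖y‖ₑ⁻¹) ^ δ)) * (‖y‖ₑ⁻¹) ^ κ :=
          mul_le_mul' (ENNReal.two_add_rpow_le hδ _) le_rfl
      _ = _ := by
          rw [ENNReal.mul_rpow_of_nonneg _ _ hδ, ENNReal.ofReal_rpow_of_pos hr,
            ENNReal.rpow_add_of_nonneg _ _ hδ hκ,
            ← ENNReal.ofReal_rpow_of_pos (x := 4) (by norm_num), ENNReal.ofReal_ofNat]
          ring
  have hAr : 0 < A * r := mul_pos hA hr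
  calc ∫⁻ y in Metric.closedBall a (A * r), singWeight δ κ r y
      ≤ ∫⁻ y in Metric.closedBall a (A * r), ENNReal.ofReal (4 ^ δ) *
          ((‖y‖ₑ⁻¹) ^ κ + ENNReal.ofReal (r ^ δ) * (‖y‖ₑ⁻¹) ^ (δ + κ)) :=
        lintegral_mono fun y => hpt y
    _ = ENNReal.ofReal (4 ^ δ) * ((∫⁻ y in Metric.closedBall a (A * r), (‖y‖ₑ⁻¹) ^ κ)
          + ENNReal.ofReal (r ^ δ) * ∫⁻ y in Metric.closedBall a (A * r), (‖y‖ₑ⁻¹) ^ (δ + κ)) := by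
        rw [lintegral_const_mul _ (by fun_prop), lintegral_add_left (by fun_prop),
          lintegral_const_mul _ (by fun_prop)]
    _ ≤ ENNReal.ofReal (4 ^ δ) * (ENNReal.ofReal (C₁ * (A * r) ^ (2 - κ))
          + ENNReal.ofReal (r ^ δ) * ENNReal.ofReal (C₂ * (A * r) ^ (2 - (δ + κ)))) := by
        gcongr
        · exact h₁ a _ hAr
        · exact h₂ a _ hAr
    _ = _ := by
        rw [← ENNReal.ofReal_mul (by positivity), ← ENNReal.ofReal_add (by positivity)
          (by positivity), ← ENNReal.ofReal_mul (by positivity)]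
        congr 1
        rw [Real.mul_rpow hA.le hr.le, Real.mul_rpow hA.le hr.le,
          show 2 - κ = (2 - (δ + κ)) + δ by ring, Real.rpow_add hr]
        ring

theorem singWeight_le_of_mul_norm_le {δ κ r c : ℝ} (hδ : 0 ≤ δ) (hκ : 0 ≤ κ) (hc : 0 < c)
    (hc1 : c ≤ 1) {y v : ℂ} (h : c * ‖v‖ ≤ ‖y‖) :
    singWeight δ κ r y ≤ ENNReal.ofReal (c⁻¹ ^ (δ + κ)) * singWeight δ κ r v := by
  have hinv : ‖y‖ₑ⁻¹ ≤ ENNReal.ofReal c⁻¹ * ‖v‖ₑ⁻¹ := by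
    have : ENNReal.ofReal c * ‖v‖ₑ ≤ ‖y‖ₑ := by
      rw [← ofReal_norm, ← ofReal_norm, ← ENNReal.ofReal_mul hc.le]
      exact ENNReal.ofReal_le_ofReal h
    rw [ENNReal.ofReal_inv_of_pos hc, ← ENNReal.mul_inv (by simp [hc]) (by simp)]
    exact ENNReal.inv_le_inv.mpr this
  have hone : (1 : ℝ≥0∞) ≤ ENNReal.ofReal c⁻¹ := by
    rw [← ENNReal.ofReal_one]
    exact ENNReal.ofReal_le_ofReal ((one_le_inv₀ hc).mpr hc1)
  have hci : 0 < c⁻¹ := inv_pos.mpr hc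
  calc singWeight δ κ r y
      ≤ (ENNReal.ofReal c⁻¹ * (2 + ENNReal.ofReal r * ‖v‖ₑ⁻¹)) ^ δ
          * (ENNReal.ofReal c⁻¹ * ‖v‖ₑ⁻¹) ^ κ := by
        unfold singWeight
        gcongr
        rw [mul_add]
        refine add_le_add (le_mul_of_one_le_left zero_le hone) ?_
        rw [mul_left_comm]
        gcongr
    _ = _ := by
        rw [ENNReal.mul_rpow_of_nonneg _ _ hδ, ENNReal.mul_rpow_of_nonneg _ _ hκ,
          Real.rpow_add hci, ENNReal.ofReal_mul (by positivity),
          ENNReal.ofReal_rpow_of_pos hci, ENNReal.ofReal_rpow_of_pos hci, singWeight]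
        ring

theorem singWeight_one_le {δ κ r : ℝ} (hδ : 0 ≤ δ) (hr : r ≤ 2) :
    singWeight δ κ r 1 ≤ ENNReal.ofReal (4 ^ δ) := by
  rw [singWeight, ← ENNReal.ofReal_rpow_of_pos (by norm_num)]
  simp only [enorm_one, inv_one, mul_one, ENNReal.one_rpow]
  gcongr
  calc (2 : ℝ≥0∞) + ENNReal.ofReal r ≤ 2 + ENNReal.ofReal 2 := by gcongr
    _ = ENNReal.ofReal 4 := by norm_num

/-- On the part of `ℂⁿ⁺¹` where the `j`-th coordinate dominates, the weight
`(1 + |z|/|ζ|)^β |ζ/ζ_{n+1}|^α` is dominated near `z` by a product of one-variable weights in the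
other coordinates. -/
theorem exists_weight_le_prod_singWeight {n : ℕ} (hn : 1 ≤ n) (j : Fin (n + 1)) {β α : ℝ}
    (hβ : 0 ≤ β) (hα : 0 ≤ α) (hα2 : α < 2) (hβα : β + α < 2 * n) :
    ∃ δ κ : Fin (n + 1) → ℝ, (∀ a, 0 ≤ δ a) ∧ (∀ a, 0 ≤ κ a) ∧ (∀ a, δ a + κ a < 2) ∧
      δ j = 0 ∧ κ j = 0 ∧ ∑ a, κ a = α ∧
      ∀ (z ζ : EuclideanSpace ℂ (Fin (n + 1))) (r : ℝ), ζ ≠ 0 → ‖ζ‖ ≤ 1 →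
        (∀ a, ‖ζ a‖ ≤ ‖ζ j‖) → ‖ζ - z‖ ≤ r →
        (1 + ‖z‖ₑ / ‖ζ‖ₑ) ^ β * (‖ζ‖ₑ / ‖ζ (Fin.last n)‖ₑ) ^ α
          ≤ ∏ a, singWeight (δ a) (κ a) r (ζ a) := by
  classical
  obtain ⟨i₀, hi₀, hlast⟩ : ∃ i₀, i₀ ≠ j ∧ (j = Fin.last n ∨ i₀ = Fin.last n) := by
    by_cases hj : j = Fin.last n
    · refine ⟨0, ?_, Or.inl hj⟩
      rw [hj]; intro h0
      have := congrArg Fin.val h0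
      simp at this; omega
    · exact ⟨Fin.last n, fun h => hj h.symm, Or.inr rfl⟩
  set κ : Fin (n + 1) → ℝ := Pi.single i₀ α with hκdef
  have hκ0 : ∀ a, 0 ≤ κ a := by
    intro a; by_cases h : a = i₀
    · subst h; simpa [κ] using hα
    · simp [κ, h]
  have hκ2 : ∀ a, κ a < 2 := by
    intro a; by_cases h : a = i₀
    · subst h; simpa [κ] using hα2
    · simp [κ, h]
  have hκj : κ j = 0 := by simp [κ, hi₀.symm]
  have hκsum : ∑ a, κ a = α := by simp [κ]
  set c : Fin (n + 1) → ℝ := fun a => 2 - κ a - Pi.single (M := fun _ => ℝ) j 2 a with hcdef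
  have hcj : c j = 0 := by simp [c, hκj]
  have hcpos : ∀ a, a ≠ j → 0 < c a := by
    intro a ha; simp only [c, Pi.single_eq_of_ne ha]; linarith [hκ2 a]
  have hcsum : ∑ a, c a = 2 * n - α := by
    simp only [c, Finset.sum_sub_distrib, hκsum]
    simp; ring
  have hs : 0 < 2 * (n : ℝ) - α := by linarith
  refine ⟨fun a => β * c a / (2 * n - α), κ, ?_, hκ0, ?_, by simp [hcj], hκj, hκsum, ?_⟩
  · intro a
    by_cases ha : a = j
    · simp [ha, hcj]
    · have := hcpos a ha; positivity
  · intro a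
    by_cases ha : a = j
    · simp [ha, hcj, hκj]
    · have hca := hcpos a ha
      have h1 : β * c a / (2 * n - α) < c a := by
        rw [div_lt_iff₀ hs, mul_comm]
        exact mul_lt_mul_of_pos_left (by linarith) hca
      have h2 : c a = 2 - κ a := by simp [c, ha]
      linarith
  · intro z ζ r hζ hζ1 hmax hr
    have hδ0 : ∀ a, 0 ≤ β * c a / (2 * n - α) := by
      intro a
      by_cases ha : a = j
      · simp [ha, hcj]
      · have := hcpos a ha; positivity
    have hδsum : ∑ a, β * c a / (2 * n - α) = β := by
      rw [← Finset.sum_div, ← Finset.mul_sum, hcsum, mul_div_assoc, div_self hs.ne', mul_one]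
    have hcoord : ∀ a, ‖ζ a‖ₑ ≤ ‖ζ‖ₑ := fun a => by
      rw [← ofReal_norm, ← ofReal_norm]
      exact ENNReal.ofReal_le_ofReal (PiLp.norm_apply_le ζ a)
    have hζe : ‖ζ‖ₑ ≠ 0 := by simpa using hζ
    have hz : ‖z‖ₑ ≤ ‖ζ‖ₑ + ENNReal.ofReal r := by
      have : ‖z‖ ≤ ‖ζ‖ + r := by
        have := norm_sub_norm_le z ζ
        rw [norm_sub_rev] at this; linarith
      rw [← ofReal_norm, ← ofReal_norm, ← ENNReal.ofReal_add (norm_nonneg _)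
        ((norm_nonneg _).trans hr)]
      exact ENNReal.ofReal_le_ofReal this
    have hbase : 1 + ‖z‖ₑ / ‖ζ‖ₑ ≤ 2 + ENNReal.ofReal r * ‖ζ‖ₑ⁻¹ := by
      calc 1 + ‖z‖ₑ / ‖ζ‖ₑ ≤ 1 + (‖ζ‖ₑ + ENNReal.ofReal r) / ‖ζ‖ₑ := by gcongr
        _ = _ := by
          rw [ENNReal.add_div, ENNReal.div_self hζe (by simp), ← add_assoc, div_eq_mul_inv,
            one_add_one_eq_two]
    have hfst : (1 + ‖z‖ₑ / ‖ζ‖ₑ) ^ β ≤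
        ∏ a, (2 + ENNReal.ofReal r * ‖ζ a‖ₑ⁻¹) ^ (β * c a / (2 * n - α)) := by
      calc (1 + ‖z‖ₑ / ‖ζ‖ₑ) ^ β
          ≤ (2 + ENNReal.ofReal r * ‖ζ‖ₑ⁻¹) ^ (∑ a, β * c a / (2 * n - α)) := by
            rw [hδsum]; gcongr
        _ = ∏ a, (2 + ENNReal.ofReal r * ‖ζ‖ₑ⁻¹) ^ (β * c a / (2 * n - α)) :=
            ENNReal.rpow_sum_of_nonneg _ _ fun a _ => hδ0 a
        _ ≤ _ := by
            refine Finset.prod_le_prod' fun a _ => ENNReal.rpow_le_rpow ?_ (hδ0 a)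
            gcongr
            exact hcoord a
    have hsnd : (‖ζ‖ₑ / ‖ζ (Fin.last n)‖ₑ) ^ α ≤ ∏ a, (‖ζ a‖ₑ⁻¹) ^ κ a := by
      rw [Fintype.prod_eq_single i₀ fun a ha => by simp [κ, ha]]
      simp only [κ, Pi.single_eq_same]
      refine ENNReal.rpow_le_rpow ?_ hα
      rw [div_eq_mul_inv]
      have h1 : ‖ζ‖ₑ ≤ 1 := by
        rw [← ofReal_norm]; exact ENNReal.ofReal_le_one.mpr hζ1
      refine (mul_le_of_le_one_left zero_le h1).trans (ENNReal.inv_le_inv.mpr ?_)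
      rcases hlast with h | h
      · rw [← h, ← ofReal_norm, ← ofReal_norm]
        exact ENNReal.ofReal_le_ofReal (hmax i₀)
      · rw [h]
    exact (mul_le_mul' hfst hsnd).trans (le_of_eq Finset.prod_mul_distrib.symm)

/-- The closed quadrants of `ℂ`. -/
def quadrant (q : Bool × Bool) : Set ℂ :=
  {a | 0 ≤ cond q.1 a.re (-a.re) ∧ 0 ≤ cond q.2 a.im (-a.im)}

theorem exists_mem_quadrant (a : ℂ) : ∃ q, a ∈ quadrant q := by
  rcases le_total 0 a.re with h | h <;> rcases le_total 0 a.im with h' | h'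
  · exact ⟨(true, true), h, h'⟩
  · exact ⟨(true, false), h, neg_nonneg.mpr h'⟩
  · exact ⟨(false, true), neg_nonneg.mpr h, h'⟩
  · exact ⟨(false, false), neg_nonneg.mpr h, neg_nonneg.mpr h'⟩

theorem zero_mem_quadrant (q : Bool × Bool) : (0 : ℂ) ∈ quadrant q := by
  obtain ⟨_ | _, _ | _⟩ := q <;> simp [quadrant]

theorem measurableSet_quadrant (q : Bool × Bool) : MeasurableSet (quadrant q) := by
  have hre : ∀ b : Bool, Measurable fun a : ℂ => cond b a.re (-a.re) := by
    rintro (_ | _)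
    exacts [Complex.measurable_re.neg, Complex.measurable_re]
  have him : ∀ b : Bool, Measurable fun a : ℂ => cond b a.im (-a.im) := by
    rintro (_ | _)
    exacts [Complex.measurable_im.neg, Complex.measurable_im]
  exact (measurableSet_le measurable_const (hre q.1)).inter
    (measurableSet_le measurable_const (him q.2))

theorem norm_add_norm_le_of_mem_quadrant {q : Bool × Bool} {a b : ℂ} (ha : a ∈ quadrant q)
    (hb : b ∈ quadrant q) : ‖a‖ + ‖b‖ ≤ 2 * ‖a + b‖ := by
  have key : 0 ≤ a.re * b.re ∧ 0 ≤ a.im * b.im := by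
    obtain ⟨_ | _, _ | _⟩ := q <;> simp only [quadrant, Set.mem_ofPred_eq, cond] at ha hb <;>
    constructor <;> nlinarith [ha.1, ha.2, hb.1, hb.2]
  have h1 : ‖a‖ ≤ ‖a + b‖ := by
    refine le_of_sq_le_sq ?_ (norm_nonneg _)
    rw [Complex.sq_norm, Complex.sq_norm, Complex.normSq_apply, Complex.normSq_apply]
    simp only [Complex.add_re, Complex.add_im]
    nlinarith [key.1, key.2, sq_nonneg b.re, sq_nonneg b.im]
  have h2 : ‖b‖ ≤ ‖a + b‖ := by
    refine le_of_sq_le_sq ?_ (norm_nonneg _)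
    rw [Complex.sq_norm, Complex.sq_norm, Complex.normSq_apply, Complex.normSq_apply]
    simp only [Complex.add_re, Complex.add_im]
    nlinarith [key.1, key.2, sq_nonneg a.re, sq_nonneg a.im]
  linarith

/-- On the quadric `∑ uᵢ² = 0`, the dominant coordinate, confined to a quadrant, is a Lipschitz
function of the other ones. -/
theorem norm_sub_le_of_sum_sq_eq_zero {ι : Type*} [Fintype ι] {j : ι} {u v : ι → ℂ}
    (hu : ∑ i, u i * u i = 0) (hv : ∑ i, v i * v i = 0) (hmu : ∀ i, ‖u i‖ ≤ ‖u j‖)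
    (hmv : ∀ i, ‖v i‖ ≤ ‖v j‖) {q : Bool × Bool} (hqu : u j ∈ quadrant q)
    (hqv : v j ∈ quadrant q) {D : ℝ} (hD : 0 ≤ D) (h : ∀ i, i ≠ j → ‖u i - v i‖ ≤ D) :
    ‖u j - v j‖ ≤ 2 * Fintype.card ι * D := by
  classical
  have hq := norm_add_norm_le_of_mem_quadrant hqu hqv
  rcases (norm_nonneg (u j + v j)).eq_or_lt with h0 | hpos
  · rw [← h0] at hq
    have h1 : ‖u j - v j‖ ≤ 0 := (norm_sub_le _ _).trans (by linarith)
    exact h1.trans (by positivity)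
  · have e : (u j - v j) * (u j + v j)
        = ∑ i ∈ Finset.univ.erase j, (v i - u i) * (u i + v i) := by
      have hu' := Finset.add_sum_erase Finset.univ (fun i => u i * u i) (Finset.mem_univ j)
      have hv' := Finset.add_sum_erase Finset.univ (fun i => v i * v i) (Finset.mem_univ j)
      have : ∑ i ∈ Finset.univ.erase j, (v i - u i) * (u i + v i)
          = ∑ i ∈ Finset.univ.erase j, v i * v i - ∑ i ∈ Finset.univ.erase j, u i * u i := by
        rw [← Finset.sum_sub_distrib]
        exact Finset.sum_congr rfl fun i _ => by ring
      rw [this]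
      linear_combination hu' - hv' + hu - hv
    have hb : ‖u j - v j‖ * ‖u j + v j‖
        ≤ Fintype.card ι * (D * (2 * ‖u j + v j‖)) := by
      rw [← norm_mul, e]
      calc _ ≤ ∑ i ∈ Finset.univ.erase j, D * (2 * ‖u j + v j‖) := by
            refine norm_sum_le_of_le _ fun i hi => ?_
            rw [norm_mul]
            refine mul_le_mul ?_ ?_ (norm_nonneg _) hD
            · rw [norm_sub_rev]; exact h i (Finset.ne_of_mem_erase hi)
            · linarith [norm_add_le (u i) (v i), hmu i, hmv i]
        _ ≤ _ := by
            rw [Finset.sum_const, nsmul_eq_mul]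
            gcongr
            exact Finset.card_le_univ _
    refine le_of_mul_le_mul_right ?_ hpos
    linarith

/-- The index set of the coordinates of `AmbN l n m`. -/
abbrev IdxN (l n m : ℕ) : Type := Fin l ⊕ (Fin (n + 1) ⊕ Fin (m + 1))

section

variable {l n m : ℕ}

/-- The coordinates other than the `j`-th of the `z`-part and the `j'`-th of the `w`-part. -/
abbrev FreeIdx (l : ℕ) {n m : ℕ} (j : Fin (n + 1)) (j' : Fin (m + 1)) : Type :=
  {i : IdxN l n m // i ≠ Sum.inr (Sum.inl j) ∧ i ≠ Sum.inr (Sum.inr j')}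

theorem card_freeIdx (j : Fin (n + 1)) (j' : Fin (m + 1)) :
    Fintype.card (FreeIdx l j j') = l + n + m := by
  have h : (Finset.univ.filter fun i : IdxN l n m =>
      i ≠ Sum.inr (Sum.inl j) ∧ i ≠ Sum.inr (Sum.inr j'))
      = (Finset.univ.erase (Sum.inr (Sum.inl j))).erase (Sum.inr (Sum.inr j')) := by
    ext i; simp [and_comm]
  rw [Fintype.card_subtype, h, Finset.card_erase_of_mem (by simp),
    Finset.card_erase_of_mem (by simp)]
  simp
  omega

/-- The vectors with both parts isotropic, whose dominant coordinates in these parts are the `j`-th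
and the `j'`-th, which lie in given quadrants. -/
def Piece (l : ℕ) {n m : ℕ} (j : Fin (n + 1)) (j' : Fin (m + 1)) (q q' : Bool × Bool) :
    Set (IdxN l n m → ℂ) :=
  {V | (∑ a, V (Sum.inr (Sum.inl a)) * V (Sum.inr (Sum.inl a)) = 0 ∧
      ∑ b, V (Sum.inr (Sum.inr b)) * V (Sum.inr (Sum.inr b)) = 0) ∧
    ((∀ a, ‖V (Sum.inr (Sum.inl a))‖ ≤ ‖V (Sum.inr (Sum.inl j))‖) ∧
      ∀ b, ‖V (Sum.inr (Sum.inr b))‖ ≤ ‖V (Sum.inr (Sum.inr j'))‖) ∧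
    V (Sum.inr (Sum.inl j)) ∈ quadrant q ∧ V (Sum.inr (Sum.inr j')) ∈ quadrant q'}

theorem measurableSet_piece (j : Fin (n + 1)) (j' : Fin (m + 1)) (q q' : Bool × Bool) :
    MeasurableSet (Piece l j j' q q') := by
  refine MeasurableSet.inter (MeasurableSet.inter ?_ ?_) (MeasurableSet.inter
    (MeasurableSet.inter ?_ ?_) (MeasurableSet.inter ?_ ?_))
  · exact measurableSet_eq_fun (by fun_prop) measurable_const
  · exact measurableSet_eq_fun (by fun_prop) measurable_const
  · exact MeasurableSet.congr (MeasurableSet.iInter fun a =>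
      measurableSet_le (f := fun V : IdxN l n m → ℂ => ‖V (Sum.inr (Sum.inl a))‖)
        (g := fun V => ‖V (Sum.inr (Sum.inl j))‖) (by fun_prop) (by fun_prop))
      (by ext; simp; rfl)
  · exact MeasurableSet.congr (MeasurableSet.iInter fun a =>
      measurableSet_le (f := fun V : IdxN l n m → ℂ => ‖V (Sum.inr (Sum.inr a))‖)
        (g := fun V => ‖V (Sum.inr (Sum.inr j'))‖) (by fun_prop) (by fun_prop))
      (by ext; simp; rfl)
  · exact measurableSet_preimage (f := fun V : IdxN l n m → ℂ => V (Sum.inr (Sum.inl j)))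
      (by fun_prop) (measurableSet_quadrant q)
  · exact measurableSet_preimage (f := fun V : IdxN l n m → ℂ => V (Sum.inr (Sum.inr j')))
      (by fun_prop) (measurableSet_quadrant q')

theorem norm_sub_le_of_mem_piece {j : Fin (n + 1)} {j' : Fin (m + 1)} {q q' : Bool × Bool}
    {V W : IdxN l n m → ℂ} (hV : V ∈ Piece l j j' q q') (hW : W ∈ Piece l j j' q q') {D : ℝ}
    (hD : 0 ≤ D) (h : ∀ i : FreeIdx l j j', ‖V i - W i‖ ≤ D) (i : IdxN l n m) :
    ‖V i - W i‖ ≤ 2 * Fintype.card (IdxN l n m) * D := by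
  have hc : (Fintype.card (IdxN l n m) : ℝ) = l + ((n + 1) + (m + 1)) := by
    simp
  by_cases hi : i = Sum.inr (Sum.inl j)
  · subst hi
    refine (norm_sub_le_of_sum_sq_eq_zero (u := fun a => V (Sum.inr (Sum.inl a)))
      (v := fun a => W (Sum.inr (Sum.inl a))) hV.1.1 hW.1.1 hV.2.1.1 hW.2.1.1 hV.2.2.1 hW.2.2.1
      hD fun a ha => h ⟨_, by simpa using ha, by simp⟩).trans ?_
    gcongr
    simp; omega
  by_cases hi' : i = Sum.inr (Sum.inr j')
  · subst hi'
    refine (norm_sub_le_of_sum_sq_eq_zero (u := fun a => V (Sum.inr (Sum.inr a)))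
      (v := fun a => W (Sum.inr (Sum.inr a))) hV.1.2 hW.1.2 hV.2.1.2 hW.2.1.2 hV.2.2.2 hW.2.2.2
      hD fun a ha => h ⟨_, by simp, by simpa using ha⟩).trans ?_
    gcongr
    simp; omega
  · refine (h ⟨i, hi, hi'⟩).trans (le_mul_of_one_le_left hD ?_)
    rw [hc]
    linarith [(Nat.cast_nonneg l : (0 : ℝ) ≤ l), (Nat.cast_nonneg n : (0 : ℝ) ≤ n),
      (Nat.cast_nonneg m : (0 : ℝ) ≤ m)]

theorem norm_le_of_mem_piece {j : Fin (n + 1)} {j' : Fin (m + 1)} {q q' : Bool × Bool}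
    {V : IdxN l n m → ℂ} (hV : V ∈ Piece l j j' q q') {D : ℝ}
    (hD : 0 ≤ D) (h : ∀ i : FreeIdx l j j', ‖V i‖ ≤ D) (i : IdxN l n m) :
    ‖V i‖ ≤ 2 * Fintype.card (IdxN l n m) * D := by
  have h0 : (0 : IdxN l n m → ℂ) ∈ Piece l j j' q q' := by
    simp [Piece, zero_mem_quadrant]
  simpa using norm_sub_le_of_mem_piece hV h0 hD (by simpa using h) i

theorem EuclideanSpace.norm_le_card_mul {ι : Type*} [Fintype ι] (x : EuclideanSpace ℂ ι) {B : ℝ}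
    (h : ∀ i, ‖x i‖ ≤ B) (hB : 0 ≤ B) : ‖x‖ ≤ Fintype.card ι * B := by
  rw [EuclideanSpace.norm_eq]
  refine Real.sqrt_le_iff.mpr ⟨by positivity, ?_⟩
  calc ∑ i, ‖x i‖ ^ 2 ≤ ∑ _i : ι, B ^ 2 := by gcongr with i; exact h i
    _ = Fintype.card ι * B ^ 2 := by simp
    _ ≤ (Fintype.card ι * Fintype.card ι : ℕ) * B ^ 2 := by
        gcongr; exact Nat.le_mul_self _
    _ = _ := by push_cast; ring

/-- The part of `𝕄_N` lying over `Piece`. -/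
def ManPiece (j : Fin (n + 1)) (j' : Fin (m + 1)) (q q' : Bool × Bool) : Set (AmbN l n m) :=
  {Θ | Θ ∈ ManN l n m ∧ (fun i => Θ i) ∈ Piece l j j' q q'}

/-- The part of `{Θ ∈ 𝕄_N : |1 - Θ • Z̄| < t}` whose dominant free coordinate is the `k`-th and
whose direction lies in `Piece`. -/
def CapPiece {j : Fin (n + 1)} {j' : Fin (m + 1)} (k : FreeIdx l j j') (q q' : Bool × Bool)
    (Z : AmbN l n m) (t : ℝ) : Set (AmbN l n m) :=
  {Θ | Θ ∈ ManN l n m ∧ Θ k ≠ 0 ∧ (fun i => Θ i / Θ k) ∈ Piece l j j' q q' ∧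
    (∀ i : FreeIdx l j j', ‖Θ i‖ ≤ ‖Θ k‖) ∧ ‖1 - bdot Θ (vconj Z)‖ < t}

open Classical in
/-- The coordinates `Θ • Z̄` and `Θᵢ / Θₖ`. -/
noncomputable def capCoord {j : Fin (n + 1)} {j' : Fin (m + 1)} (k : FreeIdx l j j')
    (Z : AmbN l n m) (Θ : AmbN l n m) (i : FreeIdx l j j') : ℂ :=
  if i = k then bdot Θ (vconj Z) else Θ i / Θ k

@[fun_prop]
theorem measurable_bdot_vconj (Z : AmbN l n m) : Measurable fun Θ => bdot Θ (vconj Z) := by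
  unfold bdot; fun_prop

theorem measurable_capCoord {j : Fin (n + 1)} {j' : Fin (m + 1)} (k : FreeIdx l j j')
    (Z : AmbN l n m) : Measurable (capCoord k Z) := by
  refine measurable_pi_lambda _ fun i => ?_
  unfold capCoord
  split_ifs
  · fun_prop
  · fun_prop

theorem measurableSet_manN : MeasurableSet (ManN l n m) := by
  have h1 : Measurable fun Z : AmbN l n m => partZ Z := by
    unfold partZ; exact (WithLp.measurable_toLp 2 _).comp (by fun_prop)
  have h2 : Measurable fun Z : AmbN l n m => partW Z := by
    unfold partW; exact (WithLp.measurable_toLp 2 _).comp (by fun_prop)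
  refine MeasurableSet.inter (MeasurableSet.inter ?_ (MeasurableSet.inter ?_
    (MeasurableSet.inter ?_ ?_))) Metric.isOpen_ball.measurableSet
  · exact (measurableSet_eq_fun h1 measurable_const).compl
  · exact (measurableSet_eq_fun h2 measurable_const).compl
  · exact measurableSet_eq_fun (by unfold bdot; fun_prop) measurable_const
  · exact measurableSet_eq_fun (by unfold bdot; fun_prop) measurable_const

theorem measurableSet_manPiece (j : Fin (n + 1)) (j' : Fin (m + 1)) (q q' : Bool × Bool) :
    MeasurableSet (ManPiece (l := l) j j' q q') :=
  measurableSet_manN.inter (measurableSet_preimage (f := fun (Θ : AmbN l n m) i => Θ i)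
    (by fun_prop) (measurableSet_piece j j' q q'))

theorem measurableSet_capPiece {j : Fin (n + 1)} {j' : Fin (m + 1)} (k : FreeIdx l j j')
    (q q' : Bool × Bool) (Z : AmbN l n m) (t : ℝ) : MeasurableSet (CapPiece k q q' Z t) := by
  refine measurableSet_manN.inter (MeasurableSet.inter ?_ (MeasurableSet.inter ?_
    (MeasurableSet.inter ?_ ?_)))
  · exact (measurableSet_eq_fun (f := fun Θ : AmbN l n m => Θ k) (by fun_prop)
      measurable_const).compl
  · exact measurableSet_preimage (f := fun (Θ : AmbN l n m) i => Θ i / Θ k)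
      (by fun_prop) (measurableSet_piece j j' q q')
  · exact MeasurableSet.congr (MeasurableSet.iInter fun i : FreeIdx l j j' =>
      measurableSet_le (f := fun Θ : AmbN l n m => ‖Θ i‖)
        (g := fun Θ => ‖Θ k‖) (by fun_prop) (by fun_prop)) (by ext; simp; rfl)
  · exact measurableSet_lt (f := fun Θ : AmbN l n m => ‖1 - bdot Θ (vconj Z)‖)
      (by fun_prop) measurable_const

theorem edist_le_of_mem_manPiece {j : Fin (n + 1)} {j' : Fin (m + 1)} {q q' : Bool × Bool}
    {x y : AmbN l n m} (hx : x ∈ ManPiece j j' q q') (hy : y ∈ ManPiece j j' q q') :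
    edist x y ≤ ((2 * Fintype.card (IdxN l n m) ^ 2 : ℕ) : NNReal) *
      edist (fun i : FreeIdx l j j' => x i) (fun i => y i) := by
  rw [edist_nndist, edist_nndist, ← ENNReal.coe_mul, ENNReal.coe_le_coe, ← NNReal.coe_le_coe]
  push_cast
  rw [dist_eq_norm]
  set D := dist (fun i : FreeIdx l j j' => x i) (fun i => y i)
  have h : ∀ i, ‖(x - y) i‖ ≤ 2 * Fintype.card (IdxN l n m) * D := fun i =>
    norm_sub_le_of_mem_piece hx.2 hy.2 dist_nonneg (fun i => by
      rw [← dist_eq_norm]; exact dist_le_pi_dist (fun i : FreeIdx l j j' => x i) (fun i => y i) i) i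
  refine (EuclideanSpace.norm_le_card_mul _ h (by positivity)).trans (le_of_eq ?_)
  ring

theorem norm_apply_le_one_of_mem_ballN {Z : AmbN l n m} (hZ : Z ∈ BallN l n m) (i : IdxN l n m) :
    ‖Z i‖ ≤ 1 :=
  (PiLp.norm_apply_le Z i).trans (mem_ball_zero_iff.mp hZ).le

theorem bdot_vconj_eq_mul {k : IdxN l n m} {Θ : AmbN l n m} (hk : Θ k ≠ 0) (Z : AmbN l n m) :
    bdot Θ (vconj Z) = Θ k * ∑ i, Θ i / Θ k * conj (Z i) := by
  rw [bdot, Finset.mul_sum]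
  refine Finset.sum_congr rfl fun i _ => ?_
  simp only [vconj]
  field_simp

theorem half_le_norm_bdot {Θ Z : AmbN l n m} {t : ℝ} (ht : t ≤ 1 / 2)
    (h : ‖1 - bdot Θ (vconj Z)‖ < t) : 1 / 2 ≤ ‖bdot Θ (vconj Z)‖ := by
  have := norm_sub_norm_le 1 (bdot Θ (vconj Z))
  rw [norm_one] at this
  linarith

theorem norm_div_le_of_mem_capPiece {j : Fin (n + 1)} {j' : Fin (m + 1)} {k : FreeIdx l j j'}
    {q q' : Bool × Bool} {Z : AmbN l n m} {t : ℝ} {x : AmbN l n m}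
    (hx : x ∈ CapPiece k q q' Z t) (i : IdxN l n m) :
    ‖x i / x k‖ ≤ 2 * Fintype.card (IdxN l n m) := by
  have := norm_le_of_mem_piece hx.2.2.1 (D := 1) zero_le_one (fun i => by
    rw [norm_div]; exact div_le_one_of_le₀ (hx.2.2.2.1 i) (norm_nonneg _)) i
  simpa using this

/-- The dominant free coordinate is bounded below on a cap. -/
theorem le_norm_of_mem_capPiece {j : Fin (n + 1)} {j' : Fin (m + 1)} {k : FreeIdx l j j'}
    {q q' : Bool × Bool} {Z : AmbN l n m} (hZ : Z ∈ BallN l n m) {t : ℝ} (ht : t ≤ 1 / 2)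
    {x : AmbN l n m} (hx : x ∈ CapPiece k q q' Z t) :
    (4 * (Fintype.card (IdxN l n m) : ℝ) ^ 2)⁻¹ ≤ ‖x k‖ := by
  have hg := half_le_norm_bdot ht hx.2.2.2.2
  rw [bdot_vconj_eq_mul hx.2.1, norm_mul] at hg
  have hG : ‖∑ i, x i / x k * conj (Z i)‖ ≤ 2 * (Fintype.card (IdxN l n m) : ℝ) ^ 2 := by
    calc _ ≤ ∑ _i : IdxN l n m, 2 * (Fintype.card (IdxN l n m) : ℝ) := by
          refine norm_sum_le_of_le _ fun i _ => ?_
          rw [norm_mul, Complex.norm_conj]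
          exact (mul_le_of_le_one_right (norm_nonneg _)
            (norm_apply_le_one_of_mem_ballN hZ i)).trans (norm_div_le_of_mem_capPiece hx i)
      _ = _ := by rw [Finset.sum_const, nsmul_eq_mul, Finset.card_univ]; ring
  have hN : (0 : ℝ) < Fintype.card (IdxN l n m) := by
    exact_mod_cast Fintype.card_pos_iff.mpr ⟨(k : IdxN l n m)⟩
  rw [inv_le_iff_one_le_mul₀ (by positivity)]
  have := mul_le_mul_of_nonneg_left hG (norm_nonneg (x k))
  linarith

theorem edist_le_of_mem_capPiece {j : Fin (n + 1)} {j' : Fin (m + 1)} {k : FreeIdx l j j'}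
    {q q' : Bool × Bool} {Z : AmbN l n m} (hZ : Z ∈ BallN l n m) {t : ℝ} (ht : t ≤ 1 / 2)
    {x y : AmbN l n m} (hx : x ∈ CapPiece k q q' Z t) (hy : y ∈ CapPiece k q q' Z t) :
    edist x y ≤ ((Fintype.card (IdxN l n m) * ((2 + 4 * Fintype.card (IdxN l n m) ^ 2) *
      (2 * Fintype.card (IdxN l n m)) + 2 * Fintype.card (IdxN l n m)) : ℕ) : NNReal) *
      edist (capCoord k Z x) (capCoord k Z y) := by
  rw [edist_nndist, edist_nndist, ← ENNReal.coe_mul, ENNReal.coe_le_coe, ← NNReal.coe_le_coe]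
  push_cast
  rw [dist_eq_norm]
  set N : ℝ := (Fintype.card (IdxN l n m) : ℝ) with hN
  have hN0 : 0 ≤ N := Nat.cast_nonneg _
  set D := dist (capCoord k Z x) (capCoord k Z y)
  have hD : 0 ≤ D := dist_nonneg
  have hcoord : ∀ i, ‖capCoord k Z x i - capCoord k Z y i‖ ≤ D := fun i => by
    rw [← dist_eq_norm]; exact dist_le_pi_dist _ _ i
  have hV : ∀ i, ‖x i / x k - y i / y k‖ ≤ 2 * N * D :=
    norm_sub_le_of_mem_piece hx.2.2.1 hy.2.2.1 hD fun i => by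
      by_cases hi : i = k
      · rw [hi, div_self hx.2.1, div_self hy.2.1, sub_self, norm_zero]; exact hD
      · simpa [capCoord, hi] using hcoord i
  have hg : ‖bdot x (vconj Z) - bdot y (vconj Z)‖ ≤ D := by
    simpa [capCoord] using hcoord k
  have hgx := half_le_norm_bdot ht hx.2.2.2.2
  rw [bdot_vconj_eq_mul hx.2.1] at hgx hg
  rw [bdot_vconj_eq_mul hy.2.1] at hg
  set G := ∑ i, x i / x k * conj (Z i)
  set G' := ∑ i, y i / y k * conj (Z i)
  have hxk := norm_apply_le_one_of_mem_ballN hx.1.2 k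
  have hyk := norm_apply_le_one_of_mem_ballN hy.1.2 k
  have hGG : ‖G - G'‖ ≤ N * (2 * N * D) := by
    rw [← Finset.sum_sub_distrib]
    calc _ ≤ ∑ _i : IdxN l n m, 2 * N * D := by
          refine norm_sum_le_of_le _ fun i _ => ?_
          rw [← sub_mul, norm_mul, Complex.norm_conj]
          exact (mul_le_of_le_one_right (norm_nonneg _)
            (norm_apply_le_one_of_mem_ballN hZ i)).trans (hV i)
      _ = _ := by rw [Finset.sum_const, nsmul_eq_mul, Finset.card_univ]
  have hG : 1 / 2 ≤ ‖G‖ := by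
    rw [norm_mul] at hgx
    exact hgx.trans (mul_le_of_le_one_left (norm_nonneg _) hxk)
  have hs : ‖x k - y k‖ ≤ (2 + 4 * N ^ 2) * D := by
    have e : (x k - y k) * G = (x k * G - y k * G') - y k * (G - G') := by ring
    have h1 : ‖x k - y k‖ * ‖G‖ ≤ D + N * (2 * N * D) := by
      rw [← norm_mul, e]
      refine (norm_sub_le _ _).trans (add_le_add hg ?_)
      rw [norm_mul]
      exact (mul_le_of_le_one_left (norm_nonneg _) hyk).trans hGG
    have h2 := mul_le_mul_of_nonneg_left hG (norm_nonneg (x k - y k))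
    linarith
  have h : ∀ i, ‖(x - y) i‖ ≤ ((2 + 4 * N ^ 2) * (2 * N) + 2 * N) * D := fun i => by
    have e : (x - y) i = (x k - y k) * (x i / x k) + y k * (x i / x k - y i / y k) := by
      have h1 := hx.2.1
      have h2 := hy.2.1
      simp only [PiLp.sub_apply]
      field_simp
      ring
    rw [e]
    refine (norm_add_le _ _).trans ?_
    rw [norm_mul, norm_mul]
    have h1 := mul_le_mul hs (norm_div_le_of_mem_capPiece hx i) (norm_nonneg _) (by positivity)
    have h2 := (mul_le_of_le_one_left (norm_nonneg (x i / x k - y i / y k)) hyk).trans (hV i)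
    linarith
  refine (EuclideanSpace.norm_le_card_mul _ h (by positivity)).trans (le_of_eq ?_)
  ring

end

theorem lintegral_fintype_prod_le {ι : Type*} [Fintype ι] {F : ι → ℂ → ℝ≥0∞}
    (hF : ∀ i, Measurable (F i)) {C e : ι → ℝ} {r : ℝ} (hr : 0 < r) (hC : ∀ i, 0 < C i)
    (h : ∀ i, ∫⁻ y, F i y ≤ ENNReal.ofReal (C i * r ^ e i)) :
    ∫⁻ y : ι → ℂ, ∏ i, F i (y i) ≤ ENNReal.ofReal ((∏ i, C i) * r ^ ∑ i, e i) := by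
  rw [lintegral_fintype_prod _ hF]
  refine (Finset.prod_le_prod' fun i _ => h i).trans (le_of_eq ?_)
  rw [← ENNReal.ofReal_prod_of_nonneg fun i _ =>
    mul_nonneg (hC i).le (Real.rpow_nonneg hr.le _), Finset.prod_mul_distrib,
    Real.rpow_sum_of_pos hr]

section

variable {l n m : ℕ}

@[to_additive]
theorem prod_freeIdx {M : Type*} [CommMonoid M] {j : Fin (n + 1)} {j' : Fin (m + 1)}
    {f : IdxN l n m → M} (h : f (Sum.inr (Sum.inl j)) = 1) (h' : f (Sum.inr (Sum.inr j')) = 1) :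
    ∏ i, f i = ∏ i : FreeIdx l j j', f i := by
  rw [← Finset.prod_filter_of_ne (p := fun i : IdxN l n m =>
    i ≠ Sum.inr (Sum.inl j) ∧ i ≠ Sum.inr (Sum.inr j')) (fun i _ hi =>
    ⟨fun e => hi (e ▸ h), fun e => hi (e ▸ h')⟩)]
  exact Finset.prod_subtype _ (by simp) f

theorem inner_eq_bdot_vconj (Z Θ : AmbN l n m) : inner ℂ Z Θ = bdot Θ (vconj Z) := by
  rw [PiLp.inner_apply, bdot]
  exact Finset.sum_congr rfl fun i _ => by simp [vconj]

theorem norm_sub_le_sqrt {Θ Z : AmbN l n m} (hΘ : Θ ∈ BallN l n m) (hZ : Z ∈ BallN l n m) {t : ℝ}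
    (h : ‖1 - bdot Θ (vconj Z)‖ < t) : ‖Θ - Z‖ ≤ √(2 * t) := by
  have hΘ1 : ‖Θ‖ < 1 := mem_ball_zero_iff.mp hΘ
  have hZ1 : ‖Z‖ < 1 := mem_ball_zero_iff.mp hZ
  have hre : 1 - (bdot Θ (vconj Z)).re < t := by
    have := (Complex.re_le_norm (1 - bdot Θ (vconj Z))).trans_lt h
    simpa using this
  have hsq : ‖Θ - Z‖ ^ 2 = ‖Θ‖ ^ 2 - 2 * (bdot Θ (vconj Z)).re + ‖Z‖ ^ 2 := by
    rw [@norm_sub_sq ℂ, ← inner_eq_bdot_vconj, inner_re_symm]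
    rfl
  refine Real.le_sqrt_of_sq_le ?_
  rw [hsq]
  nlinarith [norm_nonneg Θ, norm_nonneg Z]

theorem exists_setLIntegral_manPiece_le (j : Fin (n + 1)) (j' : Fin (m + 1))
    {δ κ : IdxN l n m → ℝ} (hδ : ∀ i, 0 ≤ δ i) (hκ : ∀ i, 0 ≤ κ i) (h : ∀ i, δ i + κ i < 2)
    (hδj : δ (Sum.inr (Sum.inl j)) = 0) (hκj : κ (Sum.inr (Sum.inl j)) = 0)
    (hδj' : δ (Sum.inr (Sum.inr j')) = 0) (hκj' : κ (Sum.inr (Sum.inr j')) = 0)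
    (q q' : Bool × Bool) :
    ∃ C : ℝ, 0 < C ∧ ∫⁻ Θ in ManPiece j j' q q', ∏ i, singWeight (δ i) (κ i) 2 (Θ i)
      ∂(μHE[2 * (l + n + m)] : Measure (AmbN l n m)) ≤ ENNReal.ofReal C := by
  obtain ⟨C₀, hC₀, hC⟩ := exists_setLIntegral_euclideanHausdorffMeasure_le (X := AmbN l n m)
    (ι := FreeIdx l j j') (l + n + m) (card_freeIdx j j')
    ((2 * Fintype.card (IdxN l n m) ^ 2 : ℕ) : NNReal)
  choose c hc0 hc using fun i : FreeIdx l j j' =>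
    exists_lintegral_singWeight_le (hδ i) (hκ i) (h i) (A := 1) one_pos
  have hF : ∀ i : FreeIdx l j j', Measurable ((Metric.closedBall (0 : ℂ) (1 * 2)).indicator
      (singWeight (δ i) (κ i) 2)) := fun i =>
    (measurable_singWeight _ _ _).indicator Metric.isClosed_closedBall.measurableSet
  have h1 := hC (ManPiece j j' q q') (fun Θ i => Θ i)
    (fun Θ => ∏ i, singWeight (δ i) (κ i) 2 (Θ i))
    (fun y => ∏ i : FreeIdx l j j', (Metric.closedBall (0 : ℂ) (1 * 2)).indicator
      (singWeight (δ i) (κ i) 2) (y i)) (measurableSet_manPiece j j' q q') (by fun_prop)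
    (Finset.measurable_prod _ fun i _ => (hF i).comp (measurable_pi_apply i))
    (fun x hx y hy => edist_le_of_mem_manPiece hx hy)
    (fun x hx => by
      rw [prod_freeIdx (j := j) (j' := j') (by simp [hδj, hκj]) (by simp [hδj', hκj'])]
      refine Finset.prod_le_prod' fun i _ => ?_
      rw [Set.indicator_of_mem]
      rw [mem_closedBall_zero_iff]
      linarith [norm_apply_le_one_of_mem_ballN hx.1.2 (i : IdxN l n m)])
  have h2 := lintegral_fintype_prod_le hF (C := c) (e := fun i => 2 - κ i) two_pos hc0
    (fun i => hc i 0 2 two_pos)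
  refine ⟨C₀.toReal * ((∏ i, c i) * 2 ^ ∑ i : FreeIdx l j j', (2 - κ i)) + 1, by
    have : 0 < ∏ i, c i := Finset.prod_pos fun i _ => hc0 i
    positivity, ?_⟩
  refine h1.trans ((mul_le_mul' le_rfl h2).trans ?_)
  nth_rewrite 1 [← ENNReal.ofReal_toReal hC₀]
  rw [← ENNReal.ofReal_mul ENNReal.toReal_nonneg]
  exact ENNReal.ofReal_le_ofReal (by linarith)

theorem exists_setLIntegral_capPiece_le {j : Fin (n + 1)} {j' : Fin (m + 1)}
    (k : FreeIdx l j j')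
    {δ κ : IdxN l n m → ℝ} (hδ : ∀ i, 0 ≤ δ i) (hκ : ∀ i, 0 ≤ κ i) (h : ∀ i, δ i + κ i < 2)
    (hδj : δ (Sum.inr (Sum.inl j)) = 0) (hκj : κ (Sum.inr (Sum.inl j)) = 0)
    (hδj' : δ (Sum.inr (Sum.inr j')) = 0) (hκj' : κ (Sum.inr (Sum.inr j')) = 0)
    (q q' : Bool × Bool) :
    ∃ C : ℝ, 0 < C ∧ ∀ Z ∈ BallN l n m, ∀ t : ℝ, 0 < t → t ≤ 1 / 2 →
      ∫⁻ Θ in CapPiece k q q' Z t, ∏ i, singWeight (δ i) (κ i) (√(2 * t)) (Θ i)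
        ∂(μHE[2 * (l + n + m)] : Measure (AmbN l n m))
      ≤ ENNReal.ofReal (C * √(2 * t) ^ (2 * ((l + n + m : ℕ) : ℝ) + 2 - ∑ i, κ i)) := by
  classical
  obtain ⟨C₀, hC₀, hC⟩ := exists_setLIntegral_euclideanHausdorffMeasure_le (X := AmbN l n m)
    (ι := FreeIdx l j j') (l + n + m) (card_freeIdx j j')
    ((Fintype.card (IdxN l n m) * ((2 + 4 * Fintype.card (IdxN l n m) ^ 2) *
      (2 * Fintype.card (IdxN l n m)) + 2 * Fintype.card (IdxN l n m)) : ℕ) : NNReal)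
  have hN : (1 : ℝ) ≤ Fintype.card (IdxN l n m) := by
    exact_mod_cast Fintype.card_pos_iff.mpr ⟨(k : IdxN l n m)⟩
  set N : ℝ := (Fintype.card (IdxN l n m) : ℝ)
  set b : ℝ := (4 * N ^ 2)⁻¹ with hb
  have hb0 : 0 < b := by positivity
  have hb1 : b ≤ 1 := inv_le_one_of_one_le₀ (by nlinarith)
  set A : ℝ := (2 + 4 * N) / b
  have hA : 0 < A := by positivity
  choose c hc0 hc using fun i : FreeIdx l j j' =>
    exists_lintegral_singWeight_le (hδ i) (hκ i) (h i) hA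
  set B : FreeIdx l j j' → ℝ := fun i => b⁻¹ ^ (δ i + κ i) * 4 ^ δ i
  have hB : ∀ i, 0 < B i := fun i => by positivity
  have hP : 0 < ∏ i : FreeIdx l j j', (if i = k then Real.pi else c i) :=
    Finset.prod_pos fun i _ => by split_ifs; exacts [Real.pi_pos, hc0 i]
  have hPB : 0 < ∏ i, B i := Finset.prod_pos fun i _ => hB i
  refine ⟨C₀.toReal * ((∏ i, B i) * ∏ i : FreeIdx l j j', (if i = k then Real.pi else c i)) + 1,
    by positivity, fun Z hZ t ht ht2 => ?_⟩
  set r := √(2 * t) with hr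
  have hr0 : 0 < r := by positivity
  have hr2 : r ^ 2 = 2 * t := Real.sq_sqrt (by positivity)
  have hr1 : r ≤ 1 := by nlinarith
  obtain ⟨a, ha⟩ : ∃ a : IdxN l n m → ℂ, ∀ x ∈ CapPiece k q q' Z t, ∀ i,
      ‖x i / x k - a i‖ ≤ A * r := by
    rcases (CapPiece k q q' Z t).eq_empty_or_nonempty with he | ⟨y, hy⟩
    · exact ⟨0, by simp [he]⟩
    · refine ⟨fun i => y i / y k, fun x hx i => ?_⟩
      have e : x i / x k - y i / y k
          = ((x i - y i) - y i / y k * (x k - y k)) / x k := by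
        have h1 := hx.2.1
        have h2 := hy.2.1
        field_simp
        ring
      have hxy : ∀ i, ‖x i - y i‖ ≤ 2 * r := fun i => by
        have h1 := norm_sub_le_sqrt hx.1.2 hZ hx.2.2.2.2
        have h2 := norm_sub_le_sqrt hy.1.2 hZ hy.2.2.2.2
        have h3 : ‖x - y‖ ≤ ‖x - Z‖ + ‖y - Z‖ := by
          rw [show x - y = (x - Z) - (y - Z) by abel]; exact norm_sub_le _ _
        have h4 := PiLp.norm_apply_le (x - y) i
        rw [PiLp.sub_apply] at h4
        linarith
      have hk := le_norm_of_mem_capPiece hZ ht2 hx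
      rw [e, norm_div, show A * r = ((2 + 4 * N) * r) / b by ring]
      refine div_le_div₀ (by positivity) ?_ hb0 hk
      refine (norm_sub_le _ _).trans ?_
      rw [norm_mul]
      have := mul_le_mul (norm_div_le_of_mem_capPiece hy i) (hxy k) (norm_nonneg _)
        (by positivity)
      linarith [hxy i]
  set F : FreeIdx l j j' → ℂ → ℝ≥0∞ := fun i =>
    if i = k then (Metric.closedBall (1 : ℂ) t).indicator 1
    else (Metric.closedBall (a i) (A * r)).indicator (singWeight (δ i) (κ i) r) with hFdef
  have hF : ∀ i, Measurable (F i) := fun i => by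
    simp only [F]
    split_ifs
    · exact measurable_one.indicator Metric.isClosed_closedBall.measurableSet
    · exact (measurable_singWeight _ _ _).indicator Metric.isClosed_closedBall.measurableSet
  have h1 := hC (CapPiece k q q' Z t) (capCoord k Z)
    (fun Θ => ∏ i, singWeight (δ i) (κ i) r (Θ i))
    (fun y => ENNReal.ofReal (∏ i, B i) * ∏ i, F i (y i)) (measurableSet_capPiece k q q' Z t)
    (measurable_capCoord k Z)
    (by
      have := Finset.measurable_prod Finset.univ fun i (_ : i ∈ Finset.univ) =>
        (hF i).comp (measurable_pi_apply i)
      exact this.const_mul _)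
    (fun x hx y hy => edist_le_of_mem_capPiece hZ ht2 hx hy)
    (fun x hx => by
      have hk := le_norm_of_mem_capPiece hZ ht2 hx
      rw [prod_freeIdx (j := j) (j' := j') (by simp [hδj, hκj]) (by simp [hδj', hκj']),
        ENNReal.ofReal_prod_of_nonneg fun i _ => (hB i).le, ← Finset.prod_mul_distrib]
      refine Finset.prod_le_prod' fun i _ => ?_
      by_cases hi : i = k
      · subst hi
        have hmem : capCoord i Z x i ∈ Metric.closedBall (1 : ℂ) t := by
          rw [mem_closedBall_iff_norm, norm_sub_rev]
          simpa [capCoord] using hx.2.2.2.2.le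
        simp only [F, if_true, Set.indicator_of_mem hmem, Pi.one_apply, mul_one]
        refine (singWeight_le_of_mul_norm_le (v := 1) (hδ _) (hκ _) hb0 hb1
          (by rwa [norm_one, mul_one])).trans ?_
        rw [ENNReal.ofReal_mul (by positivity)]
        gcongr
        exact singWeight_one_le (hδ _) (by linarith)
      · have hmem : capCoord k Z x i ∈ Metric.closedBall (a i) (A * r) := by
          rw [mem_closedBall_iff_norm]
          simpa [capCoord, hi] using ha x hx i
        simp only [F, if_neg hi, Set.indicator_of_mem hmem]
        refine (singWeight_le_of_mul_norm_le (v := capCoord k Z x i) (hδ _) (hκ _) hb0 hb1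
          ?_).trans ?_
        · simp only [capCoord, if_neg hi, norm_div]
          have hxk : 0 < ‖x k‖ := norm_pos_iff.mpr hx.2.1
          rw [mul_div_assoc', div_le_iff₀ hxk, mul_comm b]
          gcongr
        · gcongr
          exact le_mul_of_one_le_right (by positivity)
            (Real.one_le_rpow (by norm_num) (hδ _)))
  have h2 := lintegral_fintype_prod_le hF (C := fun i => if i = k then Real.pi else c i)
    (e := fun i => (2 - κ i) + if i = k then 2 else 0) hr0
    (fun i => by split_ifs; exacts [Real.pi_pos, hc0 i])
    (fun i => by
      by_cases hi : i = k
      · simp only [F, if_pos hi]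
        rw [lintegral_indicator_one Metric.isClosed_closedBall.measurableSet,
          Complex.volume_closedBall, ← ENNReal.ofReal_pow ht.le, ← NNReal.coe_real_pi,
          ENNReal.ofReal_mul (by positivity), ENNReal.ofReal_coe_nnreal, mul_comm]
        gcongr
        calc t ^ 2 ≤ r ^ (4 : ℝ) := by
              rw [show (4 : ℝ) = ((4 : ℕ) : ℝ) by norm_num, Real.rpow_natCast,
                show r ^ 4 = (r ^ 2) ^ 2 by ring, hr2]
              gcongr
              linarith
          _ ≤ _ := Real.rpow_le_rpow_of_exponent_ge hr0 hr1 (by linarith [hκ i])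
      · simp only [F, if_neg hi, add_zero]
        exact hc i (a i) r hr0)
  have hexp : ∑ i : FreeIdx l j j', ((2 - κ i) + if i = k then 2 else 0)
      = 2 * ((l + n + m : ℕ) : ℝ) + 2 - ∑ i, κ i := by
    rw [sum_freeIdx hκj hκj', Finset.sum_add_distrib, Finset.sum_sub_distrib, Finset.sum_const,
      Finset.card_univ, card_freeIdx, nsmul_eq_mul]
    simp
    ring
  rw [hexp] at h2
  refine h1.trans ?_
  rw [lintegral_const_mul' _ _ ENNReal.ofReal_ne_top]
  refine (mul_le_mul' le_rfl (mul_le_mul' le_rfl h2)).trans ?_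
  nth_rewrite 1 [← ENNReal.ofReal_toReal hC₀]
  rw [← ENNReal.ofReal_mul hPB.le, ← ENNReal.ofReal_mul ENNReal.toReal_nonneg]
  refine ENNReal.ofReal_le_ofReal ?_
  have : 0 ≤ r ^ (2 * ((l + n + m : ℕ) : ℝ) + 2 - ∑ i, κ i) := by positivity
  linarith

end

/-- Bounds that are uniform in a parameter add up over a finite covering. -/
theorem exists_setLIntegral_le_of_subset_iUnion {X ι P : Type*} [MeasurableSpace X] [Finite ι]
    {μ : Measure X} {H : P → Prop} {f : P → X → ℝ≥0∞} {S : ι → P → Set X} {T : P → Set X}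
    {b : P → ℝ} (hb : ∀ p, 0 ≤ b p) (hT : ∀ p, H p → T p ⊆ ⋃ i, S i p)
    (h : ∀ i, ∃ C : ℝ, 0 < C ∧ ∀ p, H p → ∫⁻ x in S i p, f p x ∂μ ≤ ENNReal.ofReal (C * b p)) :
    ∃ C : ℝ, 0 < C ∧ ∀ p, H p → ∫⁻ x in T p, f p x ∂μ ≤ ENNReal.ofReal (C * b p) := by
  have := Fintype.ofFinite ι
  choose C hC0 hC using h
  have hs : 0 ≤ ∑ i, C i := Finset.sum_nonneg fun i _ => (hC0 i).le
  refine ⟨∑ i, C i + 1, by linarith, fun p hp => ?_⟩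
  calc ∫⁻ x in T p, f p x ∂μ ≤ ∫⁻ x in ⋃ i, S i p, f p x ∂μ := lintegral_mono_set (hT p hp)
    _ ≤ ∑' i, ∫⁻ x in S i p, f p x ∂μ := lintegral_iUnion_le _ _
    _ = ∑ i, ∫⁻ x in S i p, f p x ∂μ := tsum_fintype _
    _ ≤ ∑ i, ENNReal.ofReal (C i * b p) := Finset.sum_le_sum fun i _ => hC i p hp
    _ = ENNReal.ofReal (∑ i, C i * b p) :=
        (ENNReal.ofReal_sum_of_nonneg fun i _ => mul_nonneg (hC0 i).le (hb p)).symm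
    _ ≤ _ := ENNReal.ofReal_le_ofReal (by
        rw [← Finset.sum_mul]; exact mul_le_mul_of_nonneg_right (by linarith) (hb p))

/-- The weight of the integral over `𝕄_N`. -/
noncomputable def weightN {l n m : ℕ} (α₁ α₂ α₃ α₄ : ℝ) (Z Θ : AmbN l n m) : ℝ≥0∞ :=
  (1 + ‖partZ Z‖ₑ / ‖partZ Θ‖ₑ) ^ α₁ * (1 + ‖partW Z‖ₑ / ‖partW Θ‖ₑ) ^ α₂
    * (‖partZ Θ‖ₑ / ‖partZ Θ (Fin.last n)‖ₑ) ^ α₃ * (‖partW Θ‖ₑ / ‖partW Θ (Fin.last m)‖ₑ) ^ α₄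

section

variable {l n m : ℕ}

theorem norm_partZ_le (Z : AmbN l n m) : ‖partZ Z‖ ≤ ‖Z‖ := by
  rw [EuclideanSpace.norm_eq, EuclideanSpace.norm_eq]
  refine Real.sqrt_le_sqrt ?_
  simp only [Fintype.sum_sum_type, partZ]
  have h1 : 0 ≤ ∑ a, ‖Z (Sum.inl a)‖ ^ 2 := by positivity
  have h2 : 0 ≤ ∑ a, ‖Z (Sum.inr (Sum.inr a))‖ ^ 2 := by positivity
  linarith

theorem norm_partW_le (Z : AmbN l n m) : ‖partW Z‖ ≤ ‖Z‖ := by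
  rw [EuclideanSpace.norm_eq, EuclideanSpace.norm_eq]
  refine Real.sqrt_le_sqrt ?_
  simp only [Fintype.sum_sum_type, partW]
  have h1 : 0 ≤ ∑ a, ‖Z (Sum.inl a)‖ ^ 2 := by positivity
  have h2 : 0 ≤ ∑ a, ‖Z (Sum.inr (Sum.inl a))‖ ^ 2 := by positivity
  linarith

theorem exists_weightN_le_prod (l : ℕ) {n m : ℕ} (hn : 1 < n) (hm : 1 < m) {α₁ α₂ α₃ α₄ : ℝ}
    (h₃ : 0 ≤ α₃) (h₃' : α₃ < 2) (h₄ : 0 ≤ α₄) (h₄' : α₄ < 2)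
    (h₁₃' : α₁ + α₃ < 2 * (n : ℝ)) (h₂₄' : α₂ + α₄ < 2 * (m : ℝ))
    (j : Fin (n + 1)) (j' : Fin (m + 1)) :
    ∃ δ κ : IdxN l n m → ℝ, (∀ i, 0 ≤ δ i) ∧ (∀ i, 0 ≤ κ i) ∧ (∀ i, δ i + κ i < 2) ∧
      δ (Sum.inr (Sum.inl j)) = 0 ∧ κ (Sum.inr (Sum.inl j)) = 0 ∧
      δ (Sum.inr (Sum.inr j')) = 0 ∧ κ (Sum.inr (Sum.inr j')) = 0 ∧ ∑ i, κ i = α₃ + α₄ ∧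
      ∀ (Z Θ : AmbN l n m) (r : ℝ), Θ ∈ ManN l n m →
        (∀ a, ‖Θ (Sum.inr (Sum.inl a))‖ ≤ ‖Θ (Sum.inr (Sum.inl j))‖) →
        (∀ a, ‖Θ (Sum.inr (Sum.inr a))‖ ≤ ‖Θ (Sum.inr (Sum.inr j'))‖) → ‖Θ - Z‖ ≤ r →
        weightN α₁ α₂ α₃ α₄ Z Θ ≤ ∏ i, singWeight (δ i) (κ i) r (Θ i) := by
  have hn' : (1 : ℝ) < n := by exact_mod_cast hn
  have hm' : (1 : ℝ) < m := by exact_mod_cast hm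
  obtain ⟨δ, κ, hδ, hκ, h, hδj, hκj, hsum, hw⟩ := exists_weight_le_prod_singWeight hn.le j
    (β := max α₁ 0) (le_max_right _ _) h₃ h₃' (by
      rcases max_cases α₁ 0 with ⟨e, -⟩ | ⟨e, -⟩ <;> rw [e] <;> linarith)
  obtain ⟨δ', κ', hδ', hκ', h', hδj', hκj', hsum', hw'⟩ := exists_weight_le_prod_singWeight hm.le j'
    (β := max α₂ 0) (le_max_right _ _) h₄ h₄' (by
      rcases max_cases α₂ 0 with ⟨e, -⟩ | ⟨e, -⟩ <;> rw [e] <;> linarith)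
  refine ⟨Sum.elim 0 (Sum.elim δ δ'), Sum.elim 0 (Sum.elim κ κ'), ?_, ?_, ?_, hδj, hκj, hδj', hκj',
    by simp [hsum, hsum'], ?_⟩
  · rintro (i | i | i) <;> simp [hδ, hδ']
  · rintro (i | i | i) <;> simp [hκ, hκ']
  · rintro (i | i | i) <;> simp [h, h']
  · intro Z Θ r hΘ hj hj' hr
    have hΘ1 : ‖Θ‖ ≤ 1 := (mem_ball_zero_iff.mp hΘ.2).le
    have e1 := hw (partZ Z) (partZ Θ) r hΘ.1.1 ((norm_partZ_le Θ).trans hΘ1) hj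
      ((norm_partZ_le (Θ - Z)).trans hr)
    have e2 := hw' (partW Z) (partW Θ) r hΘ.1.2.1 ((norm_partW_le Θ).trans hΘ1) hj'
      ((norm_partW_le (Θ - Z)).trans hr)
    simp only [Fintype.prod_sum_type, Sum.elim_inl, Sum.elim_inr, Pi.zero_apply,
      singWeight_zero_zero, Finset.prod_const_one, one_mul]
    calc weightN α₁ α₂ α₃ α₄ Z Θ
        ≤ (1 + ‖partZ Z‖ₑ / ‖partZ Θ‖ₑ) ^ max α₁ 0 * (1 + ‖partW Z‖ₑ / ‖partW Θ‖ₑ) ^ max α₂ 0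
          * (‖partZ Θ‖ₑ / ‖partZ Θ (Fin.last n)‖ₑ) ^ α₃
          * (‖partW Θ‖ₑ / ‖partW Θ (Fin.last m)‖ₑ) ^ α₄ := by
          unfold weightN
          gcongr
          · exact le_add_right le_rfl
          · exact le_max_left _ _
          · exact le_add_right le_rfl
          · exact le_max_left _ _
      _ = ((1 + ‖partZ Z‖ₑ / ‖partZ Θ‖ₑ) ^ max α₁ 0
            * (‖partZ Θ‖ₑ / ‖partZ Θ (Fin.last n)‖ₑ) ^ α₃)
          * ((1 + ‖partW Z‖ₑ / ‖partW Θ‖ₑ) ^ max α₂ 0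
            * (‖partW Θ‖ₑ / ‖partW Θ (Fin.last m)‖ₑ) ^ α₄) := by ring
      _ ≤ _ := mul_le_mul' e1 e2

theorem exists_dominant (Θ : AmbN l n m) : ∃ (j : Fin (n + 1)) (j' : Fin (m + 1)),
    (∀ a, ‖Θ (Sum.inr (Sum.inl a))‖ ≤ ‖Θ (Sum.inr (Sum.inl j))‖) ∧
      ∀ a, ‖Θ (Sum.inr (Sum.inr a))‖ ≤ ‖Θ (Sum.inr (Sum.inr j'))‖ := by
  obtain ⟨j, hj⟩ := Finite.exists_max fun a => ‖Θ (Sum.inr (Sum.inl a))‖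
  obtain ⟨j', hj'⟩ := Finite.exists_max fun a => ‖Θ (Sum.inr (Sum.inr a))‖
  exact ⟨j, j', hj, hj'⟩

theorem manN_subset_iUnion : ManN l n m ⊆
    ⋃ p : (Fin (n + 1) × Fin (m + 1)) × (Bool × Bool) × (Bool × Bool),
      ManPiece p.1.1 p.1.2 p.2.1 p.2.2 := by
  intro Θ hΘ
  obtain ⟨j, j', hj, hj'⟩ := exists_dominant Θ
  obtain ⟨q, hq⟩ := exists_mem_quadrant (Θ (Sum.inr (Sum.inl j)))
  obtain ⟨q', hq'⟩ := exists_mem_quadrant (Θ (Sum.inr (Sum.inr j')))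
  exact Set.mem_iUnion.mpr ⟨⟨⟨j, j'⟩, q, q'⟩, hΘ, hΘ.1.2.2, ⟨hj, hj'⟩, hq, hq'⟩

theorem capN_subset_iUnion (hn : 1 < n) (Z : AmbN l n m) (t : ℝ) :
    {Θ ∈ ManN l n m | ‖1 - bdot Θ (vconj Z)‖ < t} ⊆
    ⋃ p : (Σ p : Fin (n + 1) × Fin (m + 1), FreeIdx l p.1 p.2) × (Bool × Bool) × (Bool × Bool),
      CapPiece p.1.2 p.2.1 p.2.2 Z t := by
  rintro Θ ⟨hΘ, ht⟩
  obtain ⟨j, j', hj, hj'⟩ := exists_dominant Θ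
  have : Nonempty (FreeIdx l j j') := by
    rw [← Fintype.card_pos_iff, card_freeIdx]; omega
  obtain ⟨k, hk⟩ := Finite.exists_max fun i : FreeIdx l j j' => ‖Θ i‖
  have hk0 : Θ k ≠ 0 := by
    intro h0
    have hfree : ∀ i : FreeIdx l j j', Θ i = 0 := fun i => by
      have := hk i; rwa [h0, norm_zero, norm_le_zero_iff] at this
    obtain ⟨q, hq⟩ := exists_mem_quadrant (Θ (Sum.inr (Sum.inl j)))
    obtain ⟨q', hq'⟩ := exists_mem_quadrant (Θ (Sum.inr (Sum.inr j')))
    have hp : (fun i => Θ i) ∈ Piece l j j' q q' := ⟨hΘ.1.2.2, ⟨hj, hj'⟩, hq, hq'⟩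
    refine hΘ.1.1 (PiLp.ext fun a => ?_)
    have := norm_le_of_mem_piece hp le_rfl (fun i => by simp [hfree i]) (Sum.inr (Sum.inl a))
    simpa [partZ] using this
  obtain ⟨q, hq⟩ := exists_mem_quadrant (Θ (Sum.inr (Sum.inl j)) / Θ k)
  obtain ⟨q', hq'⟩ := exists_mem_quadrant (Θ (Sum.inr (Sum.inr j')) / Θ k)
  refine Set.mem_iUnion.mpr ⟨⟨⟨⟨j, j'⟩, k⟩, q, q'⟩, hΘ, hk0, ⟨⟨?_, ?_⟩, ⟨?_, ?_⟩, hq, hq'⟩, hk, ht⟩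
  · have := hΘ.1.2.2.1
    simp only [bdot, partZ] at this
    simp only [div_mul_div_comm, ← Finset.sum_div, this, zero_div]
  · have := hΘ.1.2.2.2
    simp only [bdot, partW] at this
    simp only [div_mul_div_comm, ← Finset.sum_div, this, zero_div]
  · intro a
    simp only [norm_div]
    exact div_le_div_of_nonneg_right (hj a) (norm_nonneg _)
  · intro a
    simp only [norm_div]
    exact div_le_div_of_nonneg_right (hj' a) (norm_nonneg _)

variable {α₁ α₂ α₃ α₄ : ℝ}

theorem exists_setLIntegral_weightN_le (hn : 1 < n) (hm : 1 < m)
    (h₃ : 0 ≤ α₃) (h₃' : α₃ < 2) (h₄ : 0 ≤ α₄) (h₄' : α₄ < 2)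
    (h₁₃' : α₁ + α₃ < 2 * (n : ℝ)) (h₂₄' : α₂ + α₄ < 2 * (m : ℝ)) :
    ∃ C : ℝ, 0 < C ∧ ∀ Z ∈ BallN l n m, ∫⁻ Θ in ManN l n m, weightN α₁ α₂ α₃ α₄ Z Θ
      ∂(μHE[2 * (l + n + m)]) ≤ ENNReal.ofReal (C * 1) := by
  refine exists_setLIntegral_le_of_subset_iUnion (P := AmbN l n m)
    (ι := (Fin (n + 1) × Fin (m + 1)) × (Bool × Bool) × (Bool × Bool))
    (H := fun Z => Z ∈ BallN l n m) (f := fun Z Θ => weightN α₁ α₂ α₃ α₄ Z Θ)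
    (T := fun _ => ManN l n m) (b := fun _ => 1) (fun _ => zero_le_one)
    (S := fun p _ => ManPiece p.1.1 p.1.2 p.2.1 p.2.2) (fun _ _ => manN_subset_iUnion)
    fun ⟨⟨j, j'⟩, q, q'⟩ => ?_
  obtain ⟨δ, κ, hδ, hκ, h, hδj, hκj, hδj', hκj', -, hw⟩ :=
    exists_weightN_le_prod l hn hm h₃ h₃' h₄ h₄' h₁₃' h₂₄' j j'
  obtain ⟨C, hC0, hC⟩ := exists_setLIntegral_manPiece_le j j' hδ hκ h hδj hκj hδj' hκj' q q'
  refine ⟨C, hC0, fun Z hZ => ?_⟩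
  rw [mul_one]
  refine (setLIntegral_mono' (measurableSet_manPiece j j' q q') fun Θ hΘ =>
    hw Z Θ 2 hΘ.1 hΘ.2.2.1.1 hΘ.2.2.1.2 ?_).trans hC
  have h1 : ‖Θ‖ < 1 := mem_ball_zero_iff.mp hΘ.1.2
  have h2 : ‖Z‖ < 1 := mem_ball_zero_iff.mp hZ
  linarith [norm_sub_le Θ Z]

theorem exists_setLIntegral_cap_small_le (hn : 1 < n) (hm : 1 < m)
    (h₃ : 0 ≤ α₃) (h₃' : α₃ < 2) (h₄ : 0 ≤ α₄) (h₄' : α₄ < 2)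
    (h₁₃' : α₁ + α₃ < 2 * (n : ℝ)) (h₂₄' : α₂ + α₄ < 2 * (m : ℝ)) :
    ∃ C : ℝ, 0 < C ∧ ∀ p : AmbN l n m × ℝ, (p.1 ∈ BallN l n m ∧ 0 < p.2 ∧ p.2 ≤ 1 / 2) →
      ∫⁻ Θ in {Θ ∈ ManN l n m | ‖1 - bdot Θ (vconj p.1)‖ < p.2}, weightN α₁ α₂ α₃ α₄ p.1 Θ
        ∂(μHE[2 * (l + n + m)])
      ≤ ENNReal.ofReal (C * √(2 * p.2) ^ (2 * ((l + n + m : ℕ) : ℝ) + 2 - (α₃ + α₄))) := by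
  refine exists_setLIntegral_le_of_subset_iUnion (P := AmbN l n m × ℝ)
    (ι := (Σ p : Fin (n + 1) × Fin (m + 1), FreeIdx l p.1 p.2) × (Bool × Bool) × (Bool × Bool))
    (H := fun p => p.1 ∈ BallN l n m ∧ 0 < p.2 ∧ p.2 ≤ 1 / 2)
    (f := fun p Θ => weightN α₁ α₂ α₃ α₄ p.1 Θ)
    (T := fun p => {Θ ∈ ManN l n m | ‖1 - bdot Θ (vconj p.1)‖ < p.2})
    (b := fun p => √(2 * p.2) ^ (2 * ((l + n + m : ℕ) : ℝ) + 2 - (α₃ + α₄)))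
    (fun _ => by positivity)
    (S := fun i p => CapPiece i.1.2 i.2.1 i.2.2 p.1 p.2)
    (fun p _ => capN_subset_iUnion hn p.1 p.2) fun ⟨⟨⟨j, j'⟩, k⟩, q, q'⟩ => ?_
  obtain ⟨δ, κ, hδ, hκ, h, hδj, hκj, hδj', hκj', hsum, hw⟩ :=
    exists_weightN_le_prod l hn hm h₃ h₃' h₄ h₄' h₁₃' h₂₄' j j'
  obtain ⟨C, hC0, hC⟩ := exists_setLIntegral_capPiece_le k hδ hκ h hδj hκj hδj' hκj' q q'
  refine ⟨C, hC0, fun p hp => ?_⟩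
  have hC' := hC p.1 hp.1 p.2 hp.2.1 hp.2.2
  rw [hsum] at hC'
  refine (setLIntegral_mono' (measurableSet_capPiece k q q' p.1 p.2) fun Θ hΘ =>
    hw p.1 Θ _ hΘ.1 ?_ ?_ (norm_sub_le_sqrt hΘ.1.2 hp.1 hΘ.2.2.2.2)).trans hC'
  · intro a
    have := hΘ.2.2.1.2.1.1 a
    rwa [norm_div, norm_div, div_le_div_iff_of_pos_right (norm_pos_iff.mpr hΘ.2.1)] at this
  · intro a
    have := hΘ.2.2.1.2.1.2 a
    rwa [norm_div, norm_div, div_le_div_iff_of_pos_right (norm_pos_iff.mpr hΘ.2.1)] at this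

/-- The weighted volume of the nonisotropic cap `{|1 - Θ • Z̄| < t}` of `𝕄_N`. -/
theorem exists_setLIntegral_cap_le (hn : 1 < n) (hm : 1 < m)
    (h₃ : 0 ≤ α₃) (h₃' : α₃ < 2) (h₄ : 0 ≤ α₄) (h₄' : α₄ < 2)
    (h₁₃' : α₁ + α₃ < 2 * (n : ℝ)) (h₂₄' : α₂ + α₄ < 2 * (m : ℝ)) :
    ∃ C : ℝ, 0 < C ∧ ∀ Z ∈ BallN l n m, ∀ t : ℝ, 0 < t →
      ∫⁻ Θ in {Θ ∈ ManN l n m | ‖1 - bdot Θ (vconj Z)‖ < t}, weightN α₁ α₂ α₃ α₄ Z Θ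
        ∂(μHE[2 * (l + n + m)])
      ≤ ENNReal.ofReal (C * t ^ (((l + n + m : ℕ) : ℝ) + 1 - (α₃ + α₄) / 2)) := by
  obtain ⟨C₁, hC₁, h₁⟩ := exists_setLIntegral_weightN_le (l := l) hn hm h₃ h₃' h₄ h₄' h₁₃' h₂₄'
  obtain ⟨C₂, hC₂, h₂⟩ := exists_setLIntegral_cap_small_le (l := l) hn hm h₃ h₃' h₄ h₄' h₁₃' h₂₄'
  set e : ℝ := ((l + n + m : ℕ) : ℝ) + 1 - (α₃ + α₄) / 2 with he
  have he0 : 0 ≤ e := by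
    have : (1 : ℝ) ≤ ((l + n + m : ℕ) : ℝ) := by exact_mod_cast (by omega : 1 ≤ l + n + m)
    rw [he]; linarith
  refine ⟨(C₁ + C₂) * 2 ^ e, by positivity, fun Z hZ t ht => ?_⟩
  have hpow : (2 * t) ^ e = 2 ^ e * t ^ e := Real.mul_rpow two_pos.le ht.le
  rcases le_or_gt t (1 / 2) with h | h
  · refine (h₂ (Z, t) ⟨hZ, ht, h⟩).trans (ENNReal.ofReal_le_ofReal ?_)
    rw [Real.sqrt_eq_rpow, ← Real.rpow_mul (by positivity),
      show 1 / 2 * (2 * ((l + n + m : ℕ) : ℝ) + 2 - (α₃ + α₄)) = e by rw [he]; ring, hpow,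
      mul_assoc]
    gcongr
    linarith
  · refine (lintegral_mono_set fun Θ hΘ => hΘ.1).trans
      ((h₁ Z hZ).trans (ENNReal.ofReal_le_ofReal ?_))
    rw [mul_assoc, ← hpow]
    have := Real.one_le_rpow (by linarith : 1 ≤ 2 * t) he0
    gcongr
    linarith

end

theorem theorem7p1 (l n m : ℕ) (hn : 1 < n) (hm : 1 < m) (lam : ℝ) (hlam : 0 < lam)
    (α₁ α₂ α₃ α₄ : ℝ) (h₃ : 0 ≤ α₃) (h₃' : α₃ < 2) (h₄ : 0 ≤ α₄) (h₄' : α₄ < 2)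
    (h₁₃ : 0 ≤ α₁ + α₃) (h₁₃' : α₁ + α₃ < 2 * (n : ℝ))
    (h₂₄ : 0 ≤ α₂ + α₄) (h₂₄' : α₂ + α₄ < 2 * (m : ℝ)) :
    ∃ C : ℝ, 0 < C ∧ ∀ Z ∈ BallN l n m,
      (∫⁻ Θ in ManN l n m,
          ENNReal.ofReal (kernelN lam Z Θ)
            * (1 + ‖partZ Z‖ₑ / ‖partZ Θ‖ₑ) ^ α₁
            * (1 + ‖partW Z‖ₑ / ‖partW Θ‖ₑ) ^ α₂
            * (‖partZ Θ‖ₑ / ‖partZ Θ (Fin.last n)‖ₑ) ^ α₃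
            * (‖partW Θ‖ₑ / ‖partW Θ (Fin.last m)‖ₑ) ^ α₄ ∂(volN l n m))
        ≤ ENNReal.ofReal (C * (1 - ‖Z‖ ^ 2) ^ (-(lam + α₃ / 2 + α₄ / 2))) := by
  obtain ⟨C, hC0, hC⟩ := exists_setLIntegral_cap_le (l := l) hn hm h₃ h₃' h₄ h₄' h₁₃' h₂₄'
  set e : ℝ := ((l + n + m : ℕ) : ℝ) + 1 - (α₃ + α₄) / 2 with he
  set p : ℝ := ((l + n + m : ℕ) : ℝ) + 1 + lam with hp
  set s : ℝ := lam + α₃ / 2 + α₄ / 2 with hs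
  have hs0 : 0 < s := by rw [hs]; linarith
  have hp0 : 0 ≤ p := by positivity
  have hq0 : (0 : ℝ) < 2 ^ (-s) := by positivity
  have hq1 : (2 : ℝ) ^ (-s) < 1 := Real.rpow_lt_one_of_one_lt_of_neg one_lt_two (by linarith)
  refine ⟨C * 2 ^ e * 2 ^ s * (1 - 2 ^ (-s))⁻¹, by
    have : 0 < 1 - (2 : ℝ) ^ (-s) := by linarith
    positivity, fun Z hZ => ?_⟩
  have hZ1 : ‖Z‖ < 1 := mem_ball_zero_iff.mp hZ
  have hZ2 : 0 < 1 - ‖Z‖ ^ 2 := by nlinarith [norm_nonneg Z]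
  set t : ℝ := (1 - ‖Z‖ ^ 2) / 2 with ht
  have ht0 : 0 < t := by positivity
  have hlow : ∀ Θ ∈ ManN l n m, t ≤ ‖1 - bdot Θ (vconj Z)‖ := by
    intro Θ hΘ
    have hΘ1 : ‖Θ‖ < 1 := mem_ball_zero_iff.mp hΘ.2
    have hin : inner ℂ Z Θ = bdot Θ (vconj Z) := inner_eq_bdot_vconj Z Θ
    have h1 : ‖bdot Θ (vconj Z)‖ ≤ ‖Z‖ := by
      rw [← hin]
      exact (norm_inner_le_norm _ _).trans (mul_le_of_le_one_right (norm_nonneg _) hΘ1.le)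
    have h2 := norm_sub_norm_le 1 (bdot Θ (vconj Z))
    rw [norm_one] at h2
    nlinarith [norm_nonneg Z]
  set S : ℕ → Set (AmbN l n m) := fun i =>
    {Θ ∈ ManN l n m | 2 ^ i * t ≤ ‖1 - bdot Θ (vconj Z)‖ ∧
      ‖1 - bdot Θ (vconj Z)‖ < 2 ^ (i + 1) * t} with hS
  have hSmeas : ∀ i, MeasurableSet (S i) := fun i => measurableSet_manN.inter
    ((measurableSet_le (f := fun _ => 2 ^ i * t)
      (g := fun Θ : AmbN l n m => ‖1 - bdot Θ (vconj Z)‖) measurable_const (by fun_prop)).inter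
    (measurableSet_lt (f := fun Θ : AmbN l n m => ‖1 - bdot Θ (vconj Z)‖) (by fun_prop)
      measurable_const))
  have hcov : ManN l n m ⊆ ⋃ i, S i := by
    intro Θ hΘ
    obtain ⟨i, hi1, hi2⟩ := exists_nat_pow_near ((one_le_div ht0).mpr (hlow Θ hΘ)) one_lt_two
    rw [le_div_iff₀ ht0] at hi1
    rw [div_lt_iff₀ ht0] at hi2
    exact Set.mem_iUnion.mpr ⟨i, hΘ, hi1, hi2⟩
  have hpiece : ∀ i, ∫⁻ Θ in S i, ENNReal.ofReal (kernelN lam Z Θ) * weightN α₁ α₂ α₃ α₄ Z Θ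
      ∂(μHE[2 * (l + n + m)]) ≤ ENNReal.ofReal (C * 2 ^ e * t ^ (-s) * (2 ^ (-s)) ^ i) := by
    intro i
    have hT : (0 : ℝ) < 2 ^ i * t := by positivity
    calc _ ≤ ∫⁻ Θ in S i, ENNReal.ofReal ((2 ^ i * t) ^ (-p)) * weightN α₁ α₂ α₃ α₄ Z Θ
          ∂(μHE[2 * (l + n + m)]) := by
          refine setLIntegral_mono' (hSmeas i) fun Θ hΘ => ?_
          gcongr
          rw [kernelN, Real.rpow_neg hT.le, one_div]
          have := hΘ.2.1
          gcongr
      _ = ENNReal.ofReal ((2 ^ i * t) ^ (-p)) * ∫⁻ Θ in S i, weightN α₁ α₂ α₃ α₄ Z Θ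
          ∂(μHE[2 * (l + n + m)]) := lintegral_const_mul' _ _ ENNReal.ofReal_ne_top
      _ ≤ ENNReal.ofReal ((2 ^ i * t) ^ (-p)) * ENNReal.ofReal (C * (2 ^ (i + 1) * t) ^ e) := by
          gcongr
          exact (lintegral_mono_set fun Θ hΘ => by exact ⟨hΘ.1, hΘ.2.2⟩).trans
            (hC Z hZ _ (by positivity))
      _ = _ := by
          rw [← ENNReal.ofReal_mul (by positivity)]
          congr 1
          rw [show (2 : ℝ) ^ (i + 1) * t = 2 * (2 ^ i * t) by ring,
            Real.mul_rpow two_pos.le hT.le]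
          have h1 : (2 ^ i * t) ^ (-p) * (2 ^ i * t) ^ e = t ^ (-s) * ((2 : ℝ) ^ (-s)) ^ i := by
            rw [← Real.rpow_add hT, show -p + e = -s by rw [hp, he, hs]; ring,
              Real.mul_rpow (by positivity) ht0.le, ← Real.rpow_natCast, ← Real.rpow_natCast,
              ← Real.rpow_mul two_pos.le, ← Real.rpow_mul two_pos.le, mul_comm (i : ℝ), mul_comm]
          linear_combination (C * 2 ^ e) * h1
  have hmeas : (volN l n m).restrict (ManN l n m)
      ≤ (μHE[2 * (l + n + m)] : Measure (AmbN l n m)).restrict (ManN l n m) :=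
    Measure.restrict_mono le_rfl Measure.restrict_le_self
  calc _ = ∫⁻ Θ in ManN l n m, ENNReal.ofReal (kernelN lam Z Θ) * weightN α₁ α₂ α₃ α₄ Z Θ
        ∂(volN l n m) := by simp only [weightN, mul_assoc]
    _ ≤ ∫⁻ Θ in ManN l n m, ENNReal.ofReal (kernelN lam Z Θ) * weightN α₁ α₂ α₃ α₄ Z Θ
        ∂(μHE[2 * (l + n + m)]) := lintegral_mono' hmeas le_rfl
    _ ≤ ∫⁻ Θ in ⋃ i, S i, ENNReal.ofReal (kernelN lam Z Θ) * weightN α₁ α₂ α₃ α₄ Z Θ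
        ∂(μHE[2 * (l + n + m)]) := lintegral_mono_set hcov
    _ ≤ ∑' i, ∫⁻ Θ in S i, ENNReal.ofReal (kernelN lam Z Θ) * weightN α₁ α₂ α₃ α₄ Z Θ
        ∂(μHE[2 * (l + n + m)]) := lintegral_iUnion_le _ _
    _ ≤ ∑' i : ℕ, ENNReal.ofReal (C * 2 ^ e * t ^ (-s) * (2 ^ (-s)) ^ i) :=
        ENNReal.tsum_le_tsum hpiece
    _ = ENNReal.ofReal (C * 2 ^ e * t ^ (-s) * (1 - 2 ^ (-s))⁻¹) := by
        rw [← ENNReal.ofReal_tsum_of_nonneg (fun i => by positivity)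
          ((summable_geometric_of_lt_one hq0.le hq1).mul_left _), tsum_mul_left,
          tsum_geometric_of_lt_one hq0.le hq1]
    _ = _ := by
        congr 1
        rw [ht, Real.div_rpow hZ2.le two_pos.le, Real.rpow_neg two_pos.le, div_inv_eq_mul]
        ring
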